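/- Let $(X,\mathcal B,m)$ be a $\sigma$-finite measure space and let $L$ be a selfadjoint operator in the (real or complex) Hilbert space $L^2(X,m)$ whose spectrum is bounded below; let $E_0\in\mathbb R$ be the infimum of the spectrum of $L$, and let $(e^{-tL})_{t\ge 0}$ be the strongly continuous semigroup of bounded operators with generator $-L$. Assume that the semigroup has a strictly positive kernel, i.e. that there is a measurable function $p\colon(0,\infty)\times X\times X\to(0,\infty)$, $(t,x,y)\mapsto p_t(x,y)$, such that for all $t>0$ and $f\in L^2(X,m)$ $$e^{-tL}f(x)=\int_X p_t(x,y)f(y)\,dm(y)\quad\text{for $m$-almost every }x\in X,$$ and such that (K1) $p_t(x,y)=p_t(y,x)$ for all $t>0$ and $x,y\in X$; (K2) $p_t(x,\cdot)\in L^2(X,m)$ for all $t>0$ and $x\in X$; (K3) $p_{t+s}(x,y)=\int_X p_t(x,z)\,p_s(z,y)\,dm(z)$ for all $t,s>0$ and $x,y\in X$. Then the following holds. (a) There exists a unique measurable function $\Phi\colon X\to[0,\infty)$ such that $$e^{tE_0}p_t(x,y)\to\Phi(x)\Phi(y)\qquad(t\to\infty)$$ for all $x,y\in X$. If $E_0$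 is an eigenvalue of $L$, then $\Phi(x)>0$ for every $x\in X$, and $\Phi$ is (a representative of) an eigenfunction of $L$ for the eigenvalue $E_0$ with $\|\Phi\|_{L^2(X,m)}=1$. If $E_0$ is not an eigenvalue of $L$, then $\Phi(x)=0$ for every $x\in X$. (b) For all $x,y\in X$, $$\frac{\log p_t(x,y)}{t}\to -E_0\qquad(t\to\infty).$$ -/

import Mathlib

open MeasureTheory Filter Topology

noncomputable section

namespace LinearPMap

section Hilbert

variable {𝕜 E : Type*} [RCLike 𝕜] [NormedAddCommGroup E] [InnerProductSpace 𝕜 E]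

/-- `z` lies in the resolvent set of the (possibly unbounded) operator `L`: the map
`L - z : D(L) → E` is bijective and its inverse is a bounded operator on `E`. -/
def IsResolventPoint (L : E →ₗ.[𝕜] E) (z : 𝕜) : Prop :=
  ∃ R : E →L[𝕜] E,
    (∀ f : E, ∃ hf : R f ∈ L.domain, L ⟨R f, hf⟩ - z • R f = f) ∧
    (∀ u : L.domain, R (L u - z • (u : E)) = u)

/-- The spectrum on the real axis. For a selfadjoint operator this is the whole spectrum. -/
def realSpectrum (L : E →ₗ.[𝕜] E) : Set ℝ :=
  {a : ℝ | ¬ L.IsResolventPoint (a : 𝕜)}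

/-- The ground state energy `E₀(L)`, the infimum of the spectrum of a selfadjoint operator
whose spectrum is bounded below. -/
def groundStateEnergy (L : E →ₗ.[𝕜] E) : ℝ :=
  sInf L.realSpectrum

/-- `a` is an eigenvalue of `L`. -/
def IsEigenvalue (L : E →ₗ.[𝕜] E) (a : ℝ) : Prop :=
  ∃ u : L.domain, (u : E) ≠ 0 ∧ L u = (a : 𝕜) • (u : E)

/-- `(T t)` for `t ≥ 0` is the strongly continuous semigroup of bounded operators whose
infinitesimal generator is `-L`. The values of `T` at negative times play no role. -/
structure IsSemigroupOf (L : E →ₗ.[𝕜] E) (T : ℝ → E →L[𝕜] E) : Prop where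
  zero_eq_one : T 0 = 1
  add_eq_mul : ∀ s t : ℝ, 0 ≤ s → 0 ≤ t → T (s + t) = T s * T t
  continuousOn : ∀ f : E, ContinuousOn (fun t => T t f) (Set.Ici 0)
  /-- The generator of `T`, with its natural domain of all `f` for which the right derivative of
  `t ↦ T t f` at `0` exists, is exactly `-L`. -/
  generator : ∀ f g : E,
    Tendsto (fun t : ℝ => ((t⁻¹ : ℝ) : 𝕜) • (T t f - f)) (𝓝[>] 0) (𝓝 g) ↔
      ∃ hf : f ∈ L.domain, -(L ⟨f, hf⟩) = g

open scoped Classical in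
/-- `L.expNeg t` is the operator `e^{-tL}`, for `t ≥ 0`: the member at time `t` of the strongly
continuous semigroup generated by `-L`. (Such a semigroup exists for every selfadjoint operator
that is bounded below, and it is unique, see `IsSemigroupOf.eq`.) -/
def expNeg (L : E →ₗ.[𝕜] E) (t : ℝ) : E →L[𝕜] E :=
  if h : ∃ T : ℝ → E →L[𝕜] E, L.IsSemigroupOf T then h.choose t else 0

variable {L : E →ₗ.[𝕜] E} {S T : ℝ → E →L[𝕜] E}

theorem IsSemigroupOf.exists_bound [CompleteSpace E] (hT : L.IsSemigroupOf T) (t : ℝ) :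
    ∃ C : ℝ, ∀ s ∈ Set.Icc 0 t, ‖T s‖ ≤ C := by
  have h : ∀ f : E, ∃ C, ∀ s : Set.Icc (0 : ℝ) t, ‖T s f‖ ≤ C := by
    intro f
    have hc : ContinuousOn (fun s => T s f) (Set.Icc 0 t) :=
      (hT.continuousOn f).mono fun s hs => hs.1
    obtain ⟨C, hC⟩ := (isCompact_Icc (a := (0 : ℝ)) (b := t)).exists_bound_of_continuousOn hc
    exact ⟨C, fun s => hC s s.2⟩
  obtain ⟨C, hC⟩ := banach_steinhaus h
  exact ⟨C, fun s hs => hC ⟨s, hs⟩⟩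

theorem IsSemigroupOf.mem_domain (hT : L.IsSemigroupOf T) {s : ℝ} (hs : 0 ≤ s) {f : E}
    (hf : f ∈ L.domain) : T s f ∈ L.domain := by
  have h1 := (hT.generator f _).2 ⟨hf, rfl⟩
  have h2 := ((T s).continuous.tendsto _).comp h1
  refine ((hT.generator (T s f) (T s (-(L ⟨f, hf⟩)))).1 ?_).1
  refine h2.congr' ?_
  filter_upwards [self_mem_nhdsWithin] with h hh
  have hh' : (0 : ℝ) ≤ h := le_of_lt hh
  have e : T h (T s f) = T s (T h f) := by
    have a1 := hT.add_eq_mul h s hh' hs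
    have a2 := hT.add_eq_mul s h hs hh'
    rw [add_comm, a2] at a1
    exact (congrArg (fun A : E →L[𝕜] E => A f) a1).symm
  simp [e]

/-- The semigroup is determined by the operator. -/
theorem IsSemigroupOf.eq [CompleteSpace E] (hL : Dense (L.domain : Set E))
    (hS : L.IsSemigroupOf S) (hT : L.IsSemigroupOf T) {t : ℝ} (ht : 0 ≤ t) : S t = T t := by
  let _ : NormedSpace ℝ E := NormedSpace.restrictScalars ℝ 𝕜 E
  have hsmul : ∀ (a : ℝ) (v : E), a • v = (a : 𝕜) • v := fun a v => rfl
  suffices h : ∀ f ∈ L.domain, S t f = T t f by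
    have := Continuous.ext_on hL (S t).continuous (T t).continuous fun f hf => h f hf
    exact ContinuousLinearMap.ext fun f => congrFun this f
  intro f hf
  obtain ⟨C, hC⟩ := hT.exists_bound t
  have key : ∀ (v : ℝ → E) (l : Filter ℝ),
      (∀ᶠ r in l, r ∈ Set.Icc 0 t) → Tendsto v l (𝓝 0) →
      Tendsto (fun r => T (t - r) (v r)) l (𝓝 0) := by
    intro v l hl hv
    refine squeeze_zero_norm' (a := fun r => C * ‖v r‖) ?_ ?_
    · filter_upwards [hl] with r hr
      exact (T (t - r)).le_of_opNorm_le (hC _ ⟨by linarith [hr.2], by linarith [hr.1]⟩) _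
    · simpa using (hv.norm.const_mul C)
  have hcont : ContinuousOn (fun s => T (t - s) (S s f)) (Set.Icc 0 t) := by
    intro s hs
    have h1 : Tendsto (fun r => S r f - S s f) (𝓝[Set.Icc 0 t] s) (𝓝 0) := by
      have := ((hS.continuousOn f).mono (fun r (hr : r ∈ Set.Icc 0 t) => hr.1)) s hs
      simpa using this.sub_const (S s f)
    have h2 := key _ _ self_mem_nhdsWithin h1
    have h3 : Tendsto (fun r => T (t - r) (S s f)) (𝓝[Set.Icc 0 t] s) (𝓝 (T (t - s) (S s f))) := by
      have hc : ContinuousOn (fun r => T (t - r) (S s f)) (Set.Icc 0 t) :=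
        (hT.continuousOn (S s f)).comp (by fun_prop)
          (fun r hr => by simpa using hr.2)
      exact hc s hs
    have h4 := h2.add h3
    rw [zero_add] at h4
    exact h4.congr fun r => by rw [← _root_.map_add, sub_add_cancel]
  have hder : ∀ s ∈ Set.Ico 0 t,
      HasDerivWithinAt (fun s => T (t - s) (S s f)) 0 (Set.Ici s) s := by
    intro s hs
    rw [hasDerivWithinAt_iff_tendsto_slope, Set.Ici_sdiff_left]
    have hv := hS.mem_domain hs.1 hf
    have g1 := (hS.generator (S s f) _).2 ⟨hv, rfl⟩
    have g2 := (hT.generator (S s f) _).2 ⟨hv, rfl⟩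
    have g3 := g1.sub g2
    rw [sub_self] at g3
    have sh : Tendsto (fun r : ℝ => r - s) (𝓝[>] s) (𝓝[>] 0) := by
      refine tendsto_nhdsWithin_iff.2 ⟨?_, ?_⟩
      · have : Tendsto (fun r : ℝ => r - s) (𝓝 s) (𝓝 (s - s)) := by
          exact (continuous_id.sub continuous_const).tendsto s
        rw [sub_self] at this
        exact this.mono_left nhdsWithin_le_nhds
      · filter_upwards [self_mem_nhdsWithin] with r hr
        exact sub_pos.2 (Set.mem_Ioi.1 hr)
    have g4 := g3.comp sh
    have hev : ∀ᶠ r in 𝓝[>] s, r ∈ Set.Icc 0 t := by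
      filter_upwards [self_mem_nhdsWithin, nhdsWithin_le_nhds (Iio_mem_nhds hs.2)] with r h1 h2
      exact ⟨hs.1.trans (le_of_lt h1), le_of_lt h2⟩
    have g5 := key _ _ hev g4
    refine g5.congr' ?_
    filter_upwards [self_mem_nhdsWithin, hev] with r hr hr'
    have hr0 : 0 ≤ r - s := sub_nonneg.2 (le_of_lt hr)
    have e1 : S r f = S (r - s) (S s f) := by
      have := hS.add_eq_mul (r - s) s hr0 hs.1
      rw [sub_add_cancel] at this
      rw [this]; rfl
    have e2 : T (t - s) (S s f) = T (t - r) (T (r - s) (S s f)) := by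
      have := hT.add_eq_mul (t - r) (r - s) (sub_nonneg.2 hr'.2) hr0
      rw [show t - r + (r - s) = t - s by ring] at this
      rw [this]; rfl
    rw [slope_def_module, e2, e1, hsmul, Function.comp_apply, ← smul_sub,
      sub_sub_sub_cancel_right, _root_.map_smul, _root_.map_sub]
  have h := constant_of_has_deriv_right_zero hcont hder t ⟨ht, le_rfl⟩
  simpa [hS.zero_eq_one, hT.zero_eq_one] using h

theorem IsSemigroupOf.expNeg_eq [CompleteSpace E] (hL : Dense (L.domain : Set E))
    (hT : L.IsSemigroupOf T) {t : ℝ} (ht : 0 ≤ t) : L.expNeg t = T t := by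
  have h : ∃ T : ℝ → E →L[𝕜] E, L.IsSemigroupOf T := ⟨T, hT⟩
  rw [expNeg, dif_pos h]
  exact h.choose_spec.eq hL hT ht

end Hilbert

/-- `p` is an everywhere strictly positive measurable kernel `(0,∞) × X × X → (0,∞)` of the
semigroup `(e^{-tL})` on `L²(X,m)`, symmetric, square integrable in each variable, and
satisfying the Chapman-Kolmogorov identity at all points. -/
structure HasPositiveKernel {𝕜 X : Type*} [RCLike 𝕜] [MeasurableSpace X] {m : Measure X}
    (L : Lp 𝕜 2 m →ₗ.[𝕜] Lp 𝕜 2 m) (p : ℝ → X → X → ℝ) : Prop where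
  measurable : Measurable fun q : Set.Ioi (0 : ℝ) × X × X => p q.1 q.2.1 q.2.2
  pos : ∀ t : ℝ, 0 < t → ∀ x y : X, 0 < p t x y
  expNeg_ae_eq : ∀ t : ℝ, 0 < t → ∀ f : Lp 𝕜 2 m,
    (L.expNeg t f : X → 𝕜) =ᵐ[m] fun x => ∫ y, (p t x y : 𝕜) * f y ∂m
  symm : ∀ t : ℝ, 0 < t → ∀ x y : X, p t x y = p t y x
  memLp : ∀ t : ℝ, 0 < t → ∀ x : X, MemLp (p t x) 2 m
  add_eq_integral : ∀ t s : ℝ, 0 < t → 0 < s → ∀ x y : X,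
    p (t + s) x y = ∫ z, p t x z * p s z y ∂m

end LinearPMap

end

/-!
The proof replaces the spectral theorem by elementary arguments for the symmetric semigroup
`T t = e^{-tL}` and its normalization `S t = e^{tE₀} T t`.

*Ground state energy.* From `‖T t f‖² = ⟪T (2t) f, f⟫` a norm bound at time `1` descends to all
dyadic times, and differentiating at `0` turns it into a lower bound of the form of `L`; conversely
a form bound gives exponential decay of `T t`. For a selfadjoint `L`, there is no spectrum below a
form bound, and a form bound outside the spectrum can be improved. Hence `‖T 1‖ = e^{-E₀}` and `S`
consists of contractions (`IsSemigroupOf.norm_one_eq_and_formBound`,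
`IsSemigroupOf.isSymmContractionSemigroup`).

*Convergence.* As `⟪S t f, f⟫` is decreasing in `t`, the vectors `S t f` converge to a fixed vector of
`S` (`IsSymmContractionSemigroup.exists_tendsto`), and the nonzero fixed vectors are the
eigenvectors of `L` for `E₀`. Since `p_{t+2}(x, y) = ⟪T t p₁(x, ·), p₁(y, ·)⟫`, this gives pointwise
convergence of `e^{tE₀} p_t(x, y)`, with limit zero unless `E₀` is an eigenvalue. If it is one, then
positivity of the kernel shows that the modulus of an eigenfunction is an eigenfunction, and that
the eigenspace is spanned by a strictly positive function `Φ`, so the limit is `Φ(x) Φ(y)`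
(`HasPositiveKernel.exists_pos_fixed`, `HasPositiveKernel.eq_zero_of_inner_eq_zero`).

*Growth rate.* The upper bound `e^{tE₀} p_{t+2}(x, y) ≤ ‖p₁(x, ·)‖ ‖p₁(y, ·)‖` is immediate. For the
lower bound, `h = min (p₁(x, ·), p₁(y, ·))` is strictly positive, so the vectors dominated by
multiples of `h` are dense. If `⟪S t h, h⟫ ≤ ⟪S t p₁(x, ·), p₁(y, ·)⟫` were below `e^{-εt}` at
arbitrarily large times, the same would hold, up to constants, for all `g` in this dense set.
Doubling of time in the Cauchy-Schwarz inequality then gives `⟪S 2 g, g⟫ ≤ e^{-ε} ‖g‖²`, which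
contradicts `‖S 2‖ = 1` (`IsSymmContractionSemigroup.eventually_exp_le`).
-/

namespace LinearPMap

/-! ### Selfadjoint operators that are bounded below -/

section Hilbert

variable {𝕜 E : Type*} [RCLike 𝕜] [NormedAddCommGroup E] [InnerProductSpace 𝕜 E]

local notation "⟪" x ", " y "⟫" => inner 𝕜 x y

/-- The quadratic form of `L` is bounded below by `c`, i.e. `L ≥ c`. -/
def FormBound (L : E →ₗ.[𝕜] E) (c : ℝ) : Prop :=
  ∀ u : L.domain, c * ‖(u : E)‖ ^ 2 ≤ RCLike.re ⟪L u, (u : E)⟫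

variable {L : E →ₗ.[𝕜] E} {T : ℝ → E →L[𝕜] E}

theorem inner_map_eq_of_isSelfAdjoint [CompleteSpace E] (hL : IsSelfAdjoint L) (u v : L.domain) :
    ⟪L u, (v : E)⟫ = ⟪(u : E), L v⟫ := by
  have h := adjoint_isFormalAdjoint hL.dense_domain
  rw [isSelfAdjoint_def.1 hL] at h
  exact h u v

theorem exists_map_eq_of_isSelfAdjoint [CompleteSpace E] (hL : IsSelfAdjoint L) {y w : E}
    (h : ∀ x : L.domain, ⟪w, (x : E)⟫ = ⟪y, L x⟫) : ∃ hy : y ∈ L.domain, L ⟨y, hy⟩ = w := by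
  have h1 := L.mem_adjoint_domain_of_exists y ⟨w, h⟩
  have h2 := adjoint_apply_eq hL.dense_domain ⟨y, h1⟩ h
  have h3 := isSelfAdjoint_def.1 hL
  rw! [h3] at h2
  rw [h3] at h1
  exact ⟨h1, h2⟩

theorem FormBound.le_norm {c : ℝ} (h : L.FormBound c) (z : ℝ) (u : L.domain) :
    (c - z) * ‖(u : E)‖ ≤ ‖L u - (z : 𝕜) • (u : E)‖ := by
  rcases eq_or_lt_of_le (norm_nonneg (u : E)) with h0 | h0
  · rw [← h0]; simp
  · have h1 : RCLike.re ⟪L u - (z : 𝕜) • (u : E), (u : E)⟫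
        = RCLike.re ⟪L u, (u : E)⟫ - z * ‖(u : E)‖ ^ 2 := by
      rw [inner_sub_left, inner_smul_left, inner_self_eq_norm_sq_to_K, RCLike.conj_ofReal,
        _root_.map_sub, RCLike.re_ofReal_mul]
      norm_cast
    have h2 := re_inner_le_norm (𝕜 := 𝕜) (L u - (z : 𝕜) • (u : E)) (u : E)
    have h3 := h u
    refine le_of_mul_le_mul_right ?_ h0
    nlinarith

/-- Below its form bound, a selfadjoint operator has only resolvent points: `L - z` is bounded
below, so its range is closed, and the range is dense because its orthogonal complement is the
kernel of `L - z`. -/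
theorem FormBound.isResolventPoint [CompleteSpace E] (hL : IsSelfAdjoint L) {c z : ℝ}
    (h : L.FormBound c) (hz : z < c) : L.IsResolventPoint (z : 𝕜) := by
  set A : L.domain →ₗ[𝕜] E := L.toFun - (z : 𝕜) • L.domain.subtype with hA
  have hA' : ∀ u : L.domain, A u = L u - (z : 𝕜) • (u : E) := fun u => rfl
  have hb : ∀ u : L.domain, (c - z) * ‖(u : E)‖ ≤ ‖A u‖ := h.le_norm z
  have hcz : 0 < c - z := sub_pos.2 hz
  have hinj : Function.Injective A := by
    rw [injective_iff_map_eq_zero]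
    intro u hu
    have := hb u
    rw [hu, norm_zero] at this
    have h0 : ‖(u : E)‖ ≤ 0 := by
      by_contra! hh
      nlinarith [mul_pos hcz hh]
    exact Subtype.ext (norm_le_zero_iff.1 h0)
  have hdense : (LinearMap.range A)ᗮ = ⊥ := by
    rw [Submodule.eq_bot_iff]
    intro y hy
    rw [Submodule.mem_orthogonal'] at hy
    obtain ⟨hyD, hy'⟩ := exists_map_eq_of_isSelfAdjoint hL (y := y) (w := (z : 𝕜) • y) (by
      intro x
      have h1 := hy _ ⟨x, rfl⟩
      rw [hA', inner_sub_right, sub_eq_zero] at h1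
      rw [h1, inner_smul_left, inner_smul_right, RCLike.conj_ofReal])
    have h2 : A ⟨y, hyD⟩ = 0 := by rw [hA', hy', sub_self]
    have h3 := hinj (h2.trans (_root_.map_zero A).symm)
    exact congrArg Subtype.val h3
  have hsurj : Function.Surjective A := by
    intro f
    have hf : f ∈ _root_.closure ((LinearMap.range A : Submodule 𝕜 E) : Set E) := by
      rw [← Submodule.topologicalClosure_coe, Submodule.topologicalClosure_eq_top_iff.2 hdense]
      trivial
    obtain ⟨g, hg, hgf⟩ := mem_closure_iff_seq_limit.1 hf
    choose u hu using hg
    have hcau : CauchySeq fun n => (u n : E) := by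
      rw [Metric.cauchySeq_iff]
      intro ε hε
      obtain ⟨N, hN⟩ := Metric.cauchySeq_iff.1 hgf.cauchySeq ((c - z) * ε) (mul_pos hcz hε)
      refine ⟨N, fun a ha b hb' => ?_⟩
      have h1 := hN a ha b hb'
      rw [dist_eq_norm, ← hu, ← hu, ← _root_.map_sub] at h1
      have h2 := (hb (u a - u b)).trans_lt h1
      rw [dist_eq_norm]
      exact lt_of_mul_lt_mul_left h2 hcz.le
    obtain ⟨v, hv⟩ := cauchySeq_tendsto_of_complete hcau
    obtain ⟨hvD, hv'⟩ := exists_map_eq_of_isSelfAdjoint hL (y := v) (w := f + (z : 𝕜) • v) (by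
      intro x
      have h1 : Tendsto (fun n => ⟪g n + (z : 𝕜) • (u n : E), (x : E)⟫) atTop
          (𝓝 ⟪f + (z : 𝕜) • v, (x : E)⟫) := (hgf.add (hv.const_smul (z : 𝕜))).inner tendsto_const_nhds
      have h2 : Tendsto (fun n => ⟪(u n : E), L x⟫) atTop (𝓝 ⟪v, L x⟫) :=
        hv.inner tendsto_const_nhds
      refine tendsto_nhds_unique (h1.congr fun n => ?_) h2
      rw [← hu, hA', sub_add_cancel, inner_map_eq_of_isSelfAdjoint hL])
    exact ⟨⟨v, hvD⟩, by rw [hA', hv', add_sub_cancel_right]⟩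
  let e := LinearEquiv.ofBijective A ⟨hinj, hsurj⟩
  have he : ∀ f, A (e.symm f) = f := fun f => e.apply_symm_apply f
  refine ⟨(L.domain.subtype ∘ₗ e.symm.toLinearMap).mkContinuous (c - z)⁻¹ fun f => ?_, ?_, ?_⟩
  · have := hb (e.symm f)
    rw [he] at this
    rw [inv_mul_eq_div, le_div_iff₀ hcz, mul_comm]
    exact this
  · intro f
    exact ⟨(e.symm f).2, he f⟩
  · intro u
    change ((e.symm (A u) : L.domain) : E) = u
    exact congrArg _ (e.symm_apply_apply u)

/-- If the form bound `c` is not a spectral point, then it is not sharp. -/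
theorem FormBound.improve [CompleteSpace E] (hL : IsSelfAdjoint L) {c : ℝ}
    (h : L.FormBound c) (hc : L.IsResolventPoint (c : 𝕜)) : ∃ δ > 0, L.FormBound (c + δ) := by
  obtain ⟨R, hR1, -⟩ := hc
  have hM : 0 < ‖R‖ + 1 := by positivity
  refine ⟨(‖R‖ + 1)⁻¹, inv_pos.2 hM, fun u => ?_⟩
  set s : ℝ := (‖R‖ + 1)⁻¹ with hs
  -- Nonnegativity of the form of `L - c` at `u - s R u` bounds the form at `u` from below.
  obtain ⟨hv, hv'⟩ := hR1 u
  set v : L.domain := ⟨R u, hv⟩ with hvdef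
  have hvu : L v = (u : E) + (c : 𝕜) • (v : E) := by rw [← hv']; simp [hvdef]
  have h1 := h (u - (s : 𝕜) • v)
  have hsym : ⟪L u, (v : E)⟫ = ⟪(u : E), (u : E)⟫ + c * ⟪(u : E), (v : E)⟫ := by
    rw [inner_map_eq_of_isSelfAdjoint hL, hvu, inner_add_right, inner_smul_right]
  have hn : ‖((u - (s : 𝕜) • v : L.domain) : E)‖ ^ 2
      = ‖(u : E)‖ ^ 2 - 2 * s * RCLike.re ⟪(u : E), (v : E)⟫ + s ^ 2 * ‖(v : E)‖ ^ 2 := by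
    have : ((u - (s : 𝕜) • v : L.domain) : E) = (u : E) - (s : 𝕜) • (v : E) := rfl
    rw [this, norm_sub_sq (𝕜 := 𝕜), inner_smul_right, norm_smul, RCLike.re_ofReal_mul]
    rw [RCLike.norm_ofReal, mul_pow, sq_abs]
    ring
  have hi : RCLike.re ⟪L (u - (s : 𝕜) • v), ((u - (s : 𝕜) • v : L.domain) : E)⟫
      = RCLike.re ⟪L u, (u : E)⟫ - 2 * s * ‖(u : E)‖ ^ 2
        - 2 * s * c * RCLike.re ⟪(u : E), (v : E)⟫
        + s ^ 2 * RCLike.re ⟪(u : E), (v : E)⟫ + s ^ 2 * c * ‖(v : E)‖ ^ 2 := by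
    have : ((u - (s : 𝕜) • v : L.domain) : E) = (u : E) - (s : 𝕜) • (v : E) := rfl
    rw [this, LinearPMap.map_sub, LinearPMap.map_smul, hvu]
    simp only [inner_sub_left, inner_sub_right, inner_smul_left, inner_smul_right, inner_add_left,
      hsym, RCLike.conj_ofReal, mul_add, mul_sub,
      inner_self_eq_norm_sq_to_K]
    have hvu' := inner_re_symm (𝕜 := 𝕜) (v : E) (u : E)
    have hnu (r : ℝ) (k : ℕ) : (r : 𝕜) ^ k = ((r ^ k : ℝ) : 𝕜) := by norm_cast
    simp only [_root_.map_sub, _root_.map_add, RCLike.re_ofReal_mul, hnu, RCLike.ofReal_re, hvu']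
    ring
  rw [hi, hn] at h1
  have h2 : RCLike.re ⟪(u : E), (v : E)⟫ ≤ (‖R‖ + 1) * ‖(u : E)‖ ^ 2 := by
    refine (re_inner_le_norm _ _).trans ?_
    have : ‖(v : E)‖ ≤ ‖R‖ * ‖(u : E)‖ := R.le_opNorm _
    nlinarith [norm_nonneg (u : E), sq_nonneg ‖(u : E)‖]
  have h3 : s ^ 2 * RCLike.re ⟪(u : E), (v : E)⟫ ≤ s * ‖(u : E)‖ ^ 2 := by
    have := mul_le_mul_of_nonneg_left h2 (sq_nonneg s)
    have hsM : s * (‖R‖ + 1) = 1 := inv_mul_cancel₀ hM.ne'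
    calc _ ≤ _ := this
      _ = s * (s * (‖R‖ + 1)) * ‖(u : E)‖ ^ 2 := by ring
      _ = _ := by rw [hsM, mul_one]
  nlinarith

/-! ### Semigroups of symmetric operators -/

/-- `re ⟪T (2t) f, f⟫ = ‖T t f‖²` for a symmetric semigroup. -/
theorem IsSemigroupOf.re_inner_eq (hT : L.IsSemigroupOf T)
    (hs : ∀ t, 0 ≤ t → ∀ f g, ⟪T t f, g⟫ = ⟪f, T t g⟫) {t : ℝ} (ht : 0 ≤ t) (f : E) :
    RCLike.re ⟪T (2 * t) f, f⟫ = ‖T t f‖ ^ 2 := by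
  rw [two_mul, hT.add_eq_mul t t ht ht, mul_apply_eq_comp, hs t ht,
    inner_self_eq_norm_sq]

theorem IsSemigroupOf.norm_sq_le (hT : L.IsSemigroupOf T)
    (hs : ∀ t, 0 ≤ t → ∀ f g, ⟪T t f, g⟫ = ⟪f, T t g⟫) {t : ℝ} (ht : 0 ≤ t) :
    ‖T t‖ ^ 2 ≤ ‖T (2 * t)‖ := by
  have h1 : ‖T t‖ ≤ √‖T (2 * t)‖ := by
    refine (T t).opNorm_le_bound (Real.sqrt_nonneg _) fun f => ?_
    refine abs_le_of_sq_le_sq' ?_ (by positivity) |>.2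
    rw [← hT.re_inner_eq hs ht, mul_pow, Real.sq_sqrt (norm_nonneg _)]
    refine (re_inner_le_norm _ _).trans ?_
    have := (T (2 * t)).le_opNorm f
    nlinarith [norm_nonneg f]
  calc ‖T t‖ ^ 2 ≤ (√‖T (2 * t)‖) ^ 2 := by gcongr
    _ = _ := Real.sq_sqrt (norm_nonneg _)

/-- A norm bound at time `1` descends to all dyadic times and hence bounds the form of the
generator. -/
theorem IsSemigroupOf.formBound (hT : L.IsSemigroupOf T)
    (hs : ∀ t, 0 ≤ t → ∀ f g, ⟪T t f, g⟫ = ⟪f, T t g⟫) {c : ℝ}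
    (h : ‖T 1‖ ≤ Real.exp (-c)) : L.FormBound c := by
  have hdy : ∀ n : ℕ, ‖T ((1 / 2) ^ n)‖ ≤ Real.exp (-c * (1 / 2) ^ n) := by
    intro n
    induction n with
    | zero => simpa using h
    | succ n ih =>
      have h1 := hT.norm_sq_le hs (t := (1 / 2) ^ (n + 1)) (by positivity)
      rw [show (2 : ℝ) * (1 / 2) ^ (n + 1) = (1 / 2) ^ n by ring] at h1
      refine abs_le_of_sq_le_sq' ((h1.trans ih).trans_eq ?_) (by positivity) |>.2
      rw [← Real.exp_nat_mul]
      congr 1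
      push_cast
      ring
  intro u
  have hlim : Tendsto (fun n : ℕ => ((1 / 2 : ℝ) ^ n)) atTop (𝓝[>] 0) :=
    tendsto_nhdsWithin_iff.2 ⟨tendsto_pow_atTop_nhds_zero_of_lt_one (by norm_num) (by norm_num),
      Eventually.of_forall fun n => by simp⟩
  have h1 := ((hT.generator u _).2 ⟨u.2, rfl⟩).comp hlim
  have h2 := (RCLike.continuous_re.tendsto _).comp
    (h1.inner (𝕜 := 𝕜) (tendsto_const_nhds (x := (u : E))))
  have hd : HasDerivAt (fun t : ℝ => Real.exp (-c * t) * ‖(u : E)‖ ^ 2) (-c * ‖(u : E)‖ ^ 2) 0 := by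
    have := (((hasDerivAt_id (0 : ℝ)).const_mul (-c)).exp).mul_const (‖(u : E)‖ ^ 2)
    simpa using this
  have h3 := hasDerivWithinAt_iff_tendsto_slope.1 (hd.hasDerivWithinAt (s := Set.Ioi 0))
  rw [Set.sdiff_singleton_eq_self (by simp)] at h3
  have h4 := h3.comp hlim
  have h5 := le_of_tendsto_of_tendsto' h2 h4 fun n => by
    simp only [Function.comp_apply, slope_def_field]
    have hp : (0 : ℝ) < (1 / 2) ^ n := by positivity
    rw [inner_smul_left, RCLike.conj_ofReal, RCLike.re_ofReal_mul, inner_sub_left, _root_.map_sub,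
      inner_self_eq_norm_sq, inv_mul_eq_div]
    simp only [mul_zero, Real.exp_zero, one_mul, sub_zero]
    gcongr
    refine (re_inner_le_norm _ _).trans ?_
    have h6 := (T ((1 / 2) ^ n)).le_of_opNorm_le (hdy n) (u : E)
    nlinarith [norm_nonneg (u : E)]
  simp only [inner_neg_left, _root_.map_neg] at h5
  linarith

/-- On the domain, `t ↦ T t f` has right derivative `-L (T t f)`. -/
theorem IsSemigroupOf.hasDerivWithinAt [NormedSpace ℝ E] [IsScalarTower ℝ 𝕜 E]
    (hT : L.IsSemigroupOf T) {s : ℝ} (hs : 0 ≤ s) {f : E} (hf : T s f ∈ L.domain) :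
    HasDerivWithinAt (fun t => T t f) (-(L ⟨T s f, hf⟩)) (Set.Ici s) s := by
  rw [hasDerivWithinAt_iff_tendsto_slope, Set.Ici_sdiff_left]
  have g1 := (hT.generator (T s f) _).2 ⟨hf, rfl⟩
  have sh : Tendsto (fun r : ℝ => r - s) (𝓝[>] s) (𝓝[>] 0) := by
    refine tendsto_nhdsWithin_iff.2 ⟨?_, ?_⟩
    · have : Tendsto (fun r : ℝ => r - s) (𝓝 s) (𝓝 (s - s)) :=
        (continuous_id.sub continuous_const).tendsto s
      rw [sub_self] at this
      exact this.mono_left nhdsWithin_le_nhds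
    · filter_upwards [self_mem_nhdsWithin] with r hr
      exact sub_pos.2 (Set.mem_Ioi.1 hr)
  refine (g1.comp sh).congr' ?_
  filter_upwards [self_mem_nhdsWithin] with r hr
  have hr0 : 0 ≤ r - s := sub_nonneg.2 (le_of_lt hr)
  have e1 : T r f = T (r - s) (T s f) := by
    have := hT.add_eq_mul (r - s) s hr0 hs
    rw [sub_add_cancel] at this
    rw [this]; rfl
  rw [slope_def_module, e1, Function.comp_apply, RCLike.real_smul_eq_coe_smul (K := 𝕜)]

/-- A lower form bound of the generator gives the corresponding exponential decay. -/
theorem IsSemigroupOf.norm_le [CompleteSpace E] (hL : Dense (L.domain : Set E))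
    (hT : L.IsSemigroupOf T) {c : ℝ} (h : L.FormBound c) {t : ℝ} (ht : 0 ≤ t) :
    ‖T t‖ ≤ Real.exp (-c * t) := by
  classical
  let _ : NormedSpace ℝ E := NormedSpace.restrictScalars ℝ 𝕜 E
  have _ : IsScalarTower ℝ 𝕜 E := RestrictScalars.isScalarTower ℝ 𝕜 E
  let _ : InnerProductSpace ℝ E := InnerProductSpace.rclikeToReal 𝕜 E
  refine (T t).opNorm_le_bound (Real.exp_nonneg _) fun f => ?_
  refine hL.induction (P := fun f => ‖T t f‖ ≤ Real.exp (-c * t) * ‖f‖) ?_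
    (isClosed_le (by fun_prop) (by fun_prop)) f
  intro f hf
  have hcont : ContinuousOn (fun s => ‖T s f‖ ^ 2) (Set.Icc 0 t) :=
    (((hT.continuousOn f).mono fun s hs => hs.1).norm).pow 2
  have key := image_le_of_deriv_right_le_deriv_boundary
    (f := fun s => Real.exp (2 * c * s) * ‖T s f‖ ^ 2) (a := 0) (b := t)
    (f' := fun s => if hs : T s f ∈ L.domain then
      Real.exp (2 * c * s) * (2 * c) * ‖T s f‖ ^ 2 +
        Real.exp (2 * c * s) * (2 * RCLike.re ⟪T s f, -(L ⟨T s f, hs⟩)⟫) else 0)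
    (B := fun _ => ‖f‖ ^ 2) (B' := fun _ => 0)
    ((by fun_prop : ContinuousOn (fun s : ℝ => Real.exp (2 * c * s)) _).mul hcont) ?_
    (by simp [hT.zero_eq_one]) continuousOn_const (fun s hs => hasDerivWithinAt_const _ _ _) ?_
    (x := t) ⟨ht, le_rfl⟩
  · refine abs_le_of_sq_le_sq' ?_ (by positivity) |>.2
    rw [mul_pow, ← Real.exp_nat_mul, show ((2 : ℕ) : ℝ) * (-c * t) = -(2 * c * t) by push_cast; ring,
      Real.exp_neg, inv_mul_eq_div, le_div_iff₀ (Real.exp_pos _), mul_comm]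
    exact key
  · intro s hs
    have hsD := hT.mem_domain hs.1 hf
    simp only [dif_pos hsD]
    have h1 := (hT.hasDerivWithinAt hs.1 hsD).norm_sq
    have h2 : HasDerivAt (fun s : ℝ => Real.exp (2 * c * s)) (Real.exp (2 * c * s) * (2 * c)) s := by
      have := ((hasDerivAt_id s).const_mul (2 * c)).exp
      simpa using this
    exact h2.hasDerivWithinAt.mul h1
  · intro s hs
    have hsD := hT.mem_domain hs.1 hf
    simp only [dif_pos hsD]
    have h1 := h ⟨_, hsD⟩
    rw [inner_neg_right, _root_.map_neg, inner_re_symm]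
    simp only at h1
    nlinarith [Real.exp_pos (2 * c * s)]

theorem IsSemigroupOf.apply_one_ne_zero [CompleteSpace E] [Nontrivial E]
    (hL : Dense (L.domain : Set E)) (hT : L.IsSemigroupOf T)
    (hs : ∀ t, 0 ≤ t → ∀ f g, ⟪T t f, g⟫ = ⟪f, T t g⟫) : T 1 ≠ 0 := by
  intro h0
  obtain ⟨f, hf⟩ := exists_ne (0 : E)
  have hu : ∀ u ∈ L.domain, (u : E) = 0 := by
    intro u hu
    by_contra hne
    have hpos : 0 < ‖u‖ ^ 2 := by positivity
    obtain ⟨c, hc⟩ := exists_gt (RCLike.re ⟪L ⟨u, hu⟩, u⟫ / ‖u‖ ^ 2)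
    rw [div_lt_iff₀ hpos] at hc
    have := hT.formBound hs (c := c) (by rw [h0, norm_zero]; positivity) ⟨u, hu⟩
    exact absurd hc (not_lt.2 this)
  have : _root_.closure (L.domain : Set E) ⊆ {0} :=
    closure_minimal (fun u h => hu u h) isClosed_singleton
  exact hf (this (hL f))

/-- The infimum `E₀` of the spectrum is determined by `‖T 1‖ = e^{-E₀}`, and it is a lower bound of
the form. Indeed `c = -log ‖T 1‖` is a form bound, so there is no spectrum below `c`; and `c` itself
is in the spectrum, as otherwise the form bound could be improved, and with it the decay of `T 1`. -/
theorem IsSemigroupOf.norm_one_eq_and_formBound [CompleteSpace E] [Nontrivial E] (hL : IsSelfAdjoint L)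
    (hT : L.IsSemigroupOf T) (hs : ∀ t, 0 ≤ t → ∀ f g, ⟪T t f, g⟫ = ⟪f, T t g⟫) :
    ‖T 1‖ = Real.exp (-L.groundStateEnergy) ∧ L.FormBound L.groundStateEnergy := by
  have hpos : 0 < ‖T 1‖ := norm_pos_iff.2 (hT.apply_one_ne_zero hL.dense_domain hs)
  have he : ‖T 1‖ = Real.exp (-(-Real.log ‖T 1‖)) := by rw [neg_neg, Real.exp_log hpos]
  have hf := hT.formBound hs he.le
  set c := -Real.log ‖T 1‖ with hc
  have hmem : c ∈ L.realSpectrum := by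
    intro hres
    obtain ⟨δ, hδ, h⟩ := hf.improve hL hres
    have := hT.norm_le hL.dense_domain h zero_le_one
    rw [he, Real.exp_le_exp] at this
    linarith
  have hlb : ∀ a ∈ L.realSpectrum, c ≤ a := fun a ha =>
    not_lt.1 fun hlt => ha (hf.isResolventPoint hL hlt)
  have : L.groundStateEnergy = c := IsLeast.csInf_eq ⟨hmem, hlb⟩
  rw [this]
  exact ⟨he, hf⟩

/-! ### Semigroups of symmetric contractions -/

/-- `(S t)` for `t ≥ 0` is a semigroup of symmetric contractions. No continuity is required. -/
structure IsSymmContractionSemigroup (S : ℝ → E →L[𝕜] E) : Prop where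
  add_apply : ∀ s t : ℝ, 0 ≤ s → 0 ≤ t → ∀ f, S (s + t) f = S s (S t f)
  inner_eq : ∀ t, 0 ≤ t → ∀ f g, ⟪S t f, g⟫ = ⟪f, S t g⟫
  norm_apply_le : ∀ t, 0 ≤ t → ∀ f, ‖S t f‖ ≤ ‖f‖

variable {S : ℝ → E →L[𝕜] E}

namespace IsSymmContractionSemigroup

theorem inner_add (hS : IsSymmContractionSemigroup S) {s t : ℝ} (hs : 0 ≤ s) (ht : 0 ≤ t) (f : E) :
    ⟪S (s + t) f, f⟫ = ⟪S t f, S s f⟫ := by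
  rw [hS.add_apply s t hs ht, hS.inner_eq s hs]

theorem re_inner_two_mul (hS : IsSymmContractionSemigroup S) {t : ℝ} (ht : 0 ≤ t) (f : E) :
    RCLike.re ⟪S (2 * t) f, f⟫ = ‖S t f‖ ^ 2 := by
  rw [two_mul, hS.inner_add ht ht, inner_self_eq_norm_sq]

theorem re_inner_nonneg (hS : IsSymmContractionSemigroup S) {t : ℝ} (ht : 0 ≤ t) (f : E) :
    0 ≤ RCLike.re ⟪S t f, f⟫ := by
  have := hS.re_inner_two_mul (t := t / 2) (by positivity) f
  rw [mul_div_cancel₀ _ two_ne_zero] at this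
  rw [this]
  positivity

theorem norm_apply_anti (hS : IsSymmContractionSemigroup S) {s t : ℝ} (hs : 0 ≤ s) (h : s ≤ t)
    (f : E) : ‖S t f‖ ≤ ‖S s f‖ := by
  have := hS.add_apply (t - s) s (sub_nonneg.2 h) hs f
  rw [sub_add_cancel] at this
  rw [this]
  exact hS.norm_apply_le _ (sub_nonneg.2 h) _

theorem re_inner_anti (hS : IsSymmContractionSemigroup S) {s t : ℝ} (hs : 0 ≤ s) (h : s ≤ t)
    (f : E) : RCLike.re ⟪S t f, f⟫ ≤ RCLike.re ⟪S s f, f⟫ := by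
  have h1 := hS.re_inner_two_mul (t := s / 2) (by linarith) f
  have h2 := hS.re_inner_two_mul (t := t / 2) (by linarith) f
  rw [mul_div_cancel₀ _ two_ne_zero] at h1 h2
  rw [h1, h2]
  gcongr
  exact hS.norm_apply_anti (by linarith) (by linarith) f

/-- A semigroup of symmetric contractions converges strongly, and its limits are fixed points: as
`⟪S t f, f⟫` decreases to a limit, `‖S t f - S s f‖²` tends to zero. -/
theorem exists_tendsto [CompleteSpace E] (hS : IsSymmContractionSemigroup S) (f : E) :
    ∃ g, Tendsto (fun t => S t f) atTop (𝓝 g) ∧ ∀ s, 0 ≤ s → S s g = g := by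
  have hcau : CauchySeq fun t => S t f := by
    rw [Metric.cauchySeq_iff]
    intro ε hε
    set V := (fun t => ‖S t f‖ ^ 2) '' Set.Ici 0 with hV
    have hbd : BddBelow V := ⟨0, by rintro _ ⟨t, -, rfl⟩; positivity⟩
    have hle : ∀ t, 0 ≤ t → sInf V ≤ ‖S t f‖ ^ 2 := fun t ht => csInf_le hbd ⟨t, ht, rfl⟩
    obtain ⟨_, ⟨N, hN, rfl⟩, hlt⟩ := exists_lt_of_csInf_lt (s := V) (b := sInf V + ε ^ 2 / 2)
      ⟨_, ⟨0, Set.self_mem_Ici, rfl⟩⟩ (lt_add_of_pos_right _ (by positivity))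
    have hN0 : (0 : ℝ) ≤ N := hN
    refine ⟨N, fun s hs t ht => ?_⟩
    have hs0 := hN0.trans hs
    have ht0 := hN0.trans ht
    have e1 : ‖S s f‖ ^ 2 ≤ ‖S N f‖ ^ 2 := by
      gcongr
      exact hS.norm_apply_anti hN0 hs f
    have e2 : ‖S t f‖ ^ 2 ≤ ‖S N f‖ ^ 2 := by
      gcongr
      exact hS.norm_apply_anti hN0 ht f
    have e3 := hle ((t + s) / 2) (by positivity)
    rw [← hS.re_inner_two_mul (by positivity), mul_div_cancel₀ _ two_ne_zero,
      hS.inner_add ht0 hs0] at e3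
    have e4 := norm_sub_sq (𝕜 := 𝕜) (S s f) (S t f)
    rw [dist_eq_norm]
    refine lt_of_pow_lt_pow_left₀ 2 hε.le ?_
    simp only at hlt
    linarith
  obtain ⟨g, hg⟩ := cauchySeq_tendsto_of_complete hcau
  refine ⟨g, hg, fun s hs => ?_⟩
  have h1 := ((S s).continuous.tendsto g).comp hg
  have h2 := hg.comp (tendsto_atTop_add_const_left atTop s tendsto_id)
  refine tendsto_nhds_unique (h1.congr' ?_) h2
  filter_upwards [eventually_ge_atTop 0] with t ht
  exact (hS.add_apply s t hs ht f).symm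

/-- Fixed vectors are detected by the quadratic form. -/
theorem apply_eq_of_le_re_inner (hS : IsSymmContractionSemigroup S) {t : ℝ} (ht : 0 ≤ t) {f : E}
    (h : ‖f‖ ^ 2 ≤ RCLike.re ⟪S t f, f⟫) : S t f = f := by
  have h1 := norm_sub_sq (𝕜 := 𝕜) (S t f) f
  have h2 : ‖S t f‖ ^ 2 ≤ ‖f‖ ^ 2 := by
    gcongr
    exact hS.norm_apply_le t ht f
  rw [← sub_eq_zero, ← norm_eq_zero]
  refine pow_eq_zero_iff two_ne_zero |>.1 (le_antisymm ?_ (by positivity))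
  linarith

/-- Repeated doubling of time by the Cauchy-Schwarz inequality. -/
theorem re_inner_pow_le (hS : IsSymmContractionSemigroup S) {s : ℝ} (hs : 0 ≤ s) {g : E}
    (hg : ‖g‖ = 1) (k : ℕ) :
    RCLike.re ⟪S s g, g⟫ ^ 2 ^ k ≤ RCLike.re ⟪S (2 ^ k * s) g, g⟫ := by
  induction k with
  | zero => simp
  | succ k ih =>
    have hk : (0 : ℝ) ≤ 2 ^ k * s := by positivity
    calc RCLike.re ⟪S s g, g⟫ ^ 2 ^ (k + 1) = (RCLike.re ⟪S s g, g⟫ ^ 2 ^ k) ^ 2 := by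
          rw [← pow_mul, pow_succ]
      _ ≤ RCLike.re ⟪S (2 ^ k * s) g, g⟫ ^ 2 := by
          have := hS.re_inner_nonneg hs g
          gcongr
      _ ≤ ‖S (2 ^ k * s) g‖ ^ 2 := by
          have := hS.re_inner_nonneg hk g
          gcongr
          simpa [hg] using re_inner_le_norm (𝕜 := 𝕜) (S (2 ^ k * s) g) g
      _ = RCLike.re ⟪S (2 ^ (k + 1) * s) g, g⟫ := by
          rw [← hS.re_inner_two_mul hk, pow_succ]
          ring_nf

/-- If the forms of a dense set of vectors are dominated by the form of `h`, then an exponential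
decay of the latter along a sequence of times is inherited by the whole semigroup. Hence there is
no such decay if the semigroup does not decay at time `2`. -/
theorem eventually_exp_le (hS : IsSymmContractionSemigroup S)
    (h1 : ∀ κ < 1, ∃ g, κ * ‖g‖ ^ 2 < RCLike.re ⟪S 2 g, g⟫) {G : Set E} (hG : Dense G) {h : E}
    (hGh : ∀ g ∈ G, ∃ C : ℝ, ∀ t, 0 < t →
      RCLike.re ⟪S t g, g⟫ ≤ C * RCLike.re ⟪S t h, h⟫) {ε : ℝ} (hε : 0 < ε) :
    ∀ᶠ t in atTop, Real.exp (-(ε * t)) ≤ RCLike.re ⟪S t h, h⟫ := by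
  by_contra hcon
  rw [not_eventually] at hcon
  obtain ⟨g₀, hg₀⟩ := h1 (Real.exp (-ε)) (by simpa using hε)
  refine absurd hg₀ (not_lt.2 ?_)
  refine hG.induction (P := fun g => RCLike.re ⟪S 2 g, g⟫ ≤ Real.exp (-ε) * ‖g‖ ^ 2) ?_
    (isClosed_le (by fun_prop) (by fun_prop)) g₀
  intro g hg
  rcases eq_or_ne g 0 with rfl | hg0
  · simp
  have hn : 0 < ‖g‖ := norm_pos_iff.2 hg0
  obtain ⟨C, hC⟩ := hGh g hg
  -- It suffices to treat the unit vector `e` in the direction of `g`.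
  set e : E := ((‖g‖⁻¹ : ℝ) : 𝕜) • g with he
  have hen : ‖e‖ = 1 := by
    rw [he, norm_smul, RCLike.norm_ofReal, abs_of_pos (inv_pos.2 hn), inv_mul_cancel₀ hn.ne']
  have hq : ∀ t, RCLike.re ⟪S t e, e⟫ = (‖g‖ ^ 2)⁻¹ * RCLike.re ⟪S t g, g⟫ := fun t => by
    rw [he, _root_.map_smul, inner_smul_left, inner_smul_right, RCLike.conj_ofReal,
      RCLike.re_ofReal_mul, RCLike.re_ofReal_mul, ← mul_assoc, ← mul_inv, sq]
  suffices hle : RCLike.re ⟪S 2 e, e⟫ * Real.exp ε ≤ 1 by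
    rw [hq, inv_mul_eq_div, div_mul_eq_mul_div, div_le_one (by positivity)] at hle
    rwa [Real.exp_neg, inv_mul_eq_div, le_div_iff₀ (Real.exp_pos _)]
  by_contra! hgt
  obtain ⟨N, hN⟩ := pow_unbounded_of_one_lt (max C 0 * (‖g‖ ^ 2)⁻¹) hgt
  obtain ⟨t, hlt, hge⟩ := (hcon.and_eventually (eventually_ge_atTop ((2 : ℝ) ^ (N + 1)))).exists
  rw [not_le] at hlt
  have h1t : (1 : ℝ) ≤ t := le_trans (one_le_pow₀ (by norm_num)) hge
  obtain ⟨k, hk1, hk2⟩ := exists_nat_pow_near h1t (one_lt_two : (1 : ℝ) < 2)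
  have hNk : N ≤ 2 ^ k := by
    have h3 : (2 : ℝ) ^ (N + 1) < 2 ^ (k + 1) := hge.trans_lt hk2
    have h4 := (pow_lt_pow_iff_right₀ (one_lt_two : (1 : ℝ) < 2)).1 h3
    exact (by omega : N ≤ k).trans Nat.lt_two_pow_self.le
  -- The time `s = t / 2 ^ k` lies in `[1, 2)`.
  set s := t / 2 ^ k with hs
  have hks : 2 ^ k * s = t := mul_div_cancel₀ _ (by positivity)
  have hs1 : 1 ≤ s := (one_le_div (by positivity)).2 hk1
  have hs2 : s ≤ 2 := by
    rw [hs, div_le_iff₀ (by positivity)]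
    rw [pow_succ] at hk2
    linarith
  have hq2 : 0 < RCLike.re ⟪S 2 e, e⟫ := by
    by_contra! hneg
    nlinarith [Real.exp_pos ε]
  have hfin : (RCLike.re ⟪S 2 e, e⟫ * Real.exp ε) ^ 2 ^ k ≤ max C 0 * (‖g‖ ^ 2)⁻¹ := by
    calc (RCLike.re ⟪S 2 e, e⟫ * Real.exp ε) ^ 2 ^ k
        ≤ (RCLike.re ⟪S s e, e⟫ * Real.exp (ε * s)) ^ 2 ^ k := by
          refine pow_le_pow_left₀ (by positivity) (mul_le_mul ?_ ?_ (by positivity) ?_) _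
          · exact hS.re_inner_anti (by linarith) hs2 e
          · exact Real.exp_le_exp.2 (le_mul_of_one_le_right hε.le hs1)
          · exact hS.re_inner_nonneg (by linarith) e
      _ = RCLike.re ⟪S s e, e⟫ ^ 2 ^ k * Real.exp (ε * t) := by
          rw [mul_pow, ← Real.exp_nat_mul, ← hks]
          congr 2
          push_cast
          ring
      _ ≤ RCLike.re ⟪S t e, e⟫ * Real.exp (ε * t) := by
          gcongr
          rw [← hks]
          exact hS.re_inner_pow_le (by linarith) hen k
      _ ≤ (max C 0 * (‖g‖ ^ 2)⁻¹ * Real.exp (-(ε * t))) * Real.exp (ε * t) := by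
          gcongr
          rw [hq, mul_comm (max C 0), mul_assoc]
          gcongr
          have h5 := hC t (by linarith)
          have hnn := hS.re_inner_nonneg (by linarith : 0 ≤ t) h
          calc _ ≤ C * RCLike.re ⟪S t h, h⟫ := h5
            _ ≤ max C 0 * RCLike.re ⟪S t h, h⟫ := by gcongr; exact le_max_left _ _
            _ ≤ _ := by gcongr
      _ = _ := by rw [mul_assoc, ← Real.exp_add, neg_add_cancel, Real.exp_zero, mul_one]
  exact absurd (hN.trans_le (pow_le_pow_right₀ hgt.le hNk)) (not_lt.2 hfin)

end IsSymmContractionSemigroup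

/-! ### The semigroup normalized by its ground state energy -/

/-- The semigroup `e^{tE₀} e^{-tL}`, where `E₀` is the ground state energy. -/
noncomputable def normalized (L : E →ₗ.[𝕜] E) (T : ℝ → E →L[𝕜] E) (t : ℝ) : E →L[𝕜] E :=
  (Real.exp (t * L.groundStateEnergy) : 𝕜) • T t

theorem normalized_apply (t : ℝ) (f : E) :
    normalized L T t f = (Real.exp (t * L.groundStateEnergy) : 𝕜) • T t f := rfl

theorem IsSemigroupOf.isSymmContractionSemigroup [CompleteSpace E] [Nontrivial E]
    (hL : IsSelfAdjoint L) (hT : L.IsSemigroupOf T)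
    (hs : ∀ t, 0 ≤ t → ∀ f g, ⟪T t f, g⟫ = ⟪f, T t g⟫) :
    IsSymmContractionSemigroup (normalized L T) where
  add_apply s t hs ht f := by
    simp only [normalized_apply]
    rw [hT.add_eq_mul s t hs ht, mul_apply_eq_comp, _root_.map_smul, smul_smul, add_mul,
      Real.exp_add]
    norm_cast
  inner_eq t ht f g := by
    simp only [normalized_apply]
    rw [inner_smul_left, inner_smul_right, RCLike.conj_ofReal, hs t ht]
  norm_apply_le t ht f := by
    rw [normalized_apply, norm_smul, RCLike.norm_ofReal, abs_of_pos (Real.exp_pos _)]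
    have h := (T t).le_of_opNorm_le
      (hT.norm_le hL.dense_domain (hT.norm_one_eq_and_formBound hL hs).2 ht) f
    calc _ ≤ Real.exp (t * L.groundStateEnergy) * (Real.exp (-L.groundStateEnergy * t) * ‖f‖) := by
          gcongr
      _ = ‖f‖ := by
          rw [← mul_assoc, ← Real.exp_add, show t * L.groundStateEnergy + -L.groundStateEnergy * t = 0
            by ring, Real.exp_zero, one_mul]

/-- The normalized semigroup has norm one at time `2`. -/
theorem IsSemigroupOf.exists_lt_re_inner_normalized [CompleteSpace E] [Nontrivial E]
    (hL : IsSelfAdjoint L) (hT : L.IsSemigroupOf T)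
    (hs : ∀ t, 0 ≤ t → ∀ f g, ⟪T t f, g⟫ = ⟪f, T t g⟫) {κ : ℝ} (hκ : κ < 1) :
    ∃ g, κ * ‖g‖ ^ 2 < RCLike.re ⟪normalized L T 2 g, g⟫ := by
  by_contra! hcon
  set c := L.groundStateEnergy with hc
  have hn := (hT.norm_one_eq_and_formBound hL hs).1
  have key : ∀ g, ‖T 1 g‖ ≤ √(max κ 0) * Real.exp (-c) * ‖g‖ := fun g => by
    have h1 := hcon g
    rw [normalized_apply, inner_smul_left, RCLike.conj_ofReal, RCLike.re_ofReal_mul, ← hc] at h1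
    have h2 := hT.re_inner_eq hs zero_le_one g
    rw [mul_one] at h2
    rw [h2] at h1
    refine abs_le_of_sq_le_sq' ?_ (by positivity) |>.2
    rw [mul_pow, mul_pow, Real.sq_sqrt (le_max_right _ _), ← Real.exp_nat_mul]
    have h3 : Real.exp (((2 : ℕ) : ℝ) * -c) = (Real.exp (2 * c))⁻¹ := by
      rw [← Real.exp_neg]; congr 1; push_cast; ring
    rw [h3, mul_right_comm, ← div_eq_mul_inv, le_div_iff₀ (Real.exp_pos _), mul_comm]
    refine h1.trans ?_
    gcongr
    exact le_max_left _ _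
  have h4 := (T 1).opNorm_le_bound (by positivity) key
  rw [hn] at h4
  have h5 : √(max κ 0) < 1 := by
    rw [Real.sqrt_lt' one_pos]
    simpa using hκ
  nlinarith [Real.exp_pos (-c)]

theorem IsSemigroupOf.map_eq_of_normalized_eq (hT : L.IsSemigroupOf T) {u : E}
    (h : ∀ t, 0 < t → normalized L T t u = u) :
    ∃ hu : u ∈ L.domain, L ⟨u, hu⟩ = (L.groundStateEnergy : 𝕜) • u := by
  set c := L.groundStateEnergy with hc
  obtain ⟨hu, hu'⟩ := (hT.generator u (((-c : ℝ) : 𝕜) • u)).1 (by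
    have hd : HasDerivAt (fun t : ℝ => Real.exp (-c * t)) (-c) 0 := by
      simpa using ((hasDerivAt_id (0 : ℝ)).const_mul (-c)).exp
    have h3 := hasDerivWithinAt_iff_tendsto_slope.1 (hd.hasDerivWithinAt (s := Set.Ioi 0))
    rw [Set.sdiff_singleton_eq_self (by simp)] at h3
    have h4 := (((RCLike.continuous_ofReal (K := 𝕜)).tendsto _).comp h3).smul_const u
    refine h4.congr' ?_
    filter_upwards [self_mem_nhdsWithin] with t ht
    have h5 : T t u = ((Real.exp (-c * t) : ℝ) : 𝕜) • u := by
      have h6 := h t ht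
      rw [normalized_apply] at h6
      nth_rewrite 2 [← h6]
      rw [smul_smul, ← RCLike.ofReal_mul, ← Real.exp_add, ← hc,
        show -c * t + t * c = 0 by ring, Real.exp_zero, RCLike.ofReal_one, one_smul]
    rw [h5, Function.comp_apply, slope_def_field]
    simp only [mul_zero, Real.exp_zero, sub_zero]
    rw [div_eq_inv_mul, RCLike.ofReal_mul, RCLike.ofReal_sub, mul_smul, sub_smul,
      RCLike.ofReal_one, one_smul])
  refine ⟨hu, ?_⟩
  rw [← neg_neg (L _), hu', RCLike.ofReal_neg, neg_smul, neg_neg]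

theorem IsSemigroupOf.normalized_eq_of_map_eq (hT : L.IsSemigroupOf T) {u : L.domain}
    (h : L u = (L.groundStateEnergy : 𝕜) • (u : E)) {t : ℝ} (ht : 0 ≤ t) :
    normalized L T t u = u := by
  let _ : NormedSpace ℝ E := NormedSpace.restrictScalars ℝ 𝕜 E
  have _ : IsScalarTower ℝ 𝕜 E := RestrictScalars.isScalarTower ℝ 𝕜 E
  set c := L.groundStateEnergy with hc
  have hsmul : ∀ (a : ℝ) (v : E), (a : 𝕜) • v = a • v := fun a v =>
    (RCLike.real_smul_eq_coe_smul (K := 𝕜) a v).symm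
  simp only [hsmul] at h
  have hcomm : ∀ s, 0 ≤ s → ∃ hs : T s u ∈ L.domain, L ⟨T s u, hs⟩ = c • T s (u : E) := by
    intro s hs
    have h1 := (hT.generator u _).2 ⟨u.2, rfl⟩
    have h2 := ((T s).continuous.tendsto _).comp h1
    obtain ⟨h3, h4⟩ := (hT.generator (T s u) (T s (-(L u)))).1 (by
      refine h2.congr' ?_
      filter_upwards [self_mem_nhdsWithin] with r hr
      have hr' : (0 : ℝ) ≤ r := le_of_lt hr
      have e : T r (T s u) = T s (T r u) := by
        have a1 := hT.add_eq_mul r s hr' hs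
        rw [add_comm, hT.add_eq_mul s r hs hr'] at a1
        exact (congrArg (fun A : E →L[𝕜] E => A u) a1).symm
      simp [e])
    refine ⟨h3, ?_⟩
    rw [← neg_neg (L _), h4, _root_.map_neg, neg_neg, h, ← hsmul, ← hsmul, _root_.map_smul]
  have hcont : ContinuousOn (fun s => Real.exp (s * c) • T s u) (Set.Icc 0 t) :=
    (by fun_prop : ContinuousOn (fun s => Real.exp (s * c)) _).smul
      ((hT.continuousOn u).mono fun s hs => hs.1)
  have hder : ∀ s ∈ Set.Ico 0 t,
      HasDerivWithinAt (fun s => Real.exp (s * c) • T s u) 0 (Set.Ici s) s := by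
    intro s hs
    obtain ⟨h1, h2⟩ := hcomm s hs.1
    have h3 := hT.hasDerivWithinAt hs.1 h1
    have h4 : HasDerivAt (fun s : ℝ => Real.exp (s * c)) (Real.exp (s * c) * c) s := by
      simpa using ((hasDerivAt_id s).mul_const c).exp
    have h5 := h4.hasDerivWithinAt (s := Set.Ici s) |>.smul h3
    refine h5.congr_deriv ?_
    rw [h2, smul_neg, smul_smul, neg_add_cancel]
  have := constant_of_has_deriv_right_zero hcont hder t ⟨ht, le_rfl⟩
  rw [normalized_apply, hsmul, this]
  simp [hT.zero_eq_one]

end Hilbert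

/-! ### Real functions in `L²` -/

section Lp

variable {𝕜 X : Type*} [RCLike 𝕜] [MeasurableSpace X] {m : Measure X}

local notation "⟪" x ", " y "⟫" => inner 𝕜 x y

/-- The element of `L²(X, m; 𝕜)` given by a real square integrable function. -/
noncomputable def ofRealLp (𝕜 : Type*) [RCLike 𝕜] {k : X → ℝ} (hk : MemLp k 2 m) : Lp 𝕜 2 m :=
  (hk.ofReal (K := 𝕜)).toLp _

theorem coeFn_ofRealLp {k : X → ℝ} (hk : MemLp k 2 m) :
    ofRealLp 𝕜 hk =ᵐ[m] fun x => (k x : 𝕜) := MemLp.coeFn_toLp _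

theorem inner_eq_integral_of_ae_eq {f g : Lp 𝕜 2 m} {k l : X → ℝ} (hf : f =ᵐ[m] fun x => (k x : 𝕜))
    (hg : g =ᵐ[m] fun x => (l x : 𝕜)) : ⟪f, g⟫ = ((∫ x, k x * l x ∂m : ℝ) : 𝕜) := by
  rw [L2.inner_def, ← integral_ofReal]
  refine integral_congr_ae ?_
  filter_upwards [hf, hg] with x h1 h2
  rw [h1, h2, RCLike.inner_apply', RCLike.conj_ofReal, RCLike.ofReal_mul]

/-- The vectors dominated by a multiple of a strictly positive function are dense, since a vector
`f` orthogonal to all its truncations `1_{‖f‖ ≤ n k} f` vanishes. -/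
theorem dense_setOf_norm_le {k : X → ℝ} (hk : Measurable k) (hpos : ∀ x, 0 < k x) :
    Dense {g : Lp 𝕜 2 m | ∃ C, 0 ≤ C ∧ ∀ᵐ x ∂m, ‖g x‖ ≤ C * k x} := by
  let G : Submodule 𝕜 (Lp 𝕜 2 m) :=
    { carrier := {g : Lp 𝕜 2 m | ∃ C, 0 ≤ C ∧ ∀ᵐ x ∂m, ‖g x‖ ≤ C * k x}
      zero_mem' := ⟨0, le_rfl, by
        filter_upwards [Lp.coeFn_zero 𝕜 2 m] with x hx
        exact (congrArg norm hx).le.trans (by simp)⟩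
      add_mem' := by
        rintro a b ⟨C, hC, ha⟩ ⟨D, hD, hb⟩
        refine ⟨C + D, add_nonneg hC hD, ?_⟩
        filter_upwards [ha, hb, Lp.coeFn_add a b] with x h1 h2 h3
        rw [h3, add_mul]
        exact (norm_add_le _ _).trans (add_le_add h1 h2)
      smul_mem' := by
        rintro c a ⟨C, hC, ha⟩
        refine ⟨‖c‖ * C, by positivity, ?_⟩
        filter_upwards [ha, Lp.coeFn_smul c a] with x h1 h2
        rw [h2, Pi.smul_apply, norm_smul, mul_assoc]
        gcongr }
  change Dense (G : Set (Lp 𝕜 2 m))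
  rw [Submodule.dense_iff_topologicalClosure_eq_top, Submodule.topologicalClosure_eq_top_iff,
    Submodule.eq_bot_iff]
  intro f hf
  rw [Submodule.mem_orthogonal] at hf
  have hfm : Measurable fun x => ‖f x‖ := (Lp.stronglyMeasurable f).norm.measurable
  have key : ∀ n : ℕ, ∀ᵐ x ∂m, ‖f x‖ ≤ n * k x → f x = 0 := by
    intro n
    set A : Set X := {x | ‖f x‖ ≤ n * k x} with hA
    have hAm : MeasurableSet A := measurableSet_le hfm (hk.const_mul _)
    have hmem : MemLp (A.indicator f) 2 m := (Lp.memLp f).indicator hAm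
    have h1 := hf (hmem.toLp _) ⟨n, n.cast_nonneg, by
      filter_upwards [hmem.coeFn_toLp] with x hx
      rw [hx]
      by_cases hxA : x ∈ A
      · rw [Set.indicator_of_mem hxA]
        exact hxA
      · rw [Set.indicator_of_notMem hxA, norm_zero]
        exact mul_nonneg n.cast_nonneg (hpos x).le⟩
    have hint : Integrable (fun x => A.indicator (fun x => ‖f x‖ ^ 2) x) m :=
      ((Lp.memLp f).integrable_norm_pow two_ne_zero).indicator hAm
    have h2 : ∫ x, A.indicator (fun x => ‖f x‖ ^ 2) x ∂m = 0 := by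
      rw [L2.inner_def] at h1
      have h3 : ∫ x, ((A.indicator (fun x => ‖f x‖ ^ 2) x : ℝ) : 𝕜) ∂m = 0 := by
        rw [← h1]
        refine integral_congr_ae ?_
        filter_upwards [hmem.coeFn_toLp] with x hx
        rw [hx]
        by_cases hxA : x ∈ A
        · rw [Set.indicator_of_mem hxA, Set.indicator_of_mem hxA, inner_self_eq_norm_sq_to_K,
            RCLike.ofReal_pow]
        · rw [Set.indicator_of_notMem hxA, Set.indicator_of_notMem hxA, inner_zero_left,
            RCLike.ofReal_zero]
      rw [integral_ofReal] at h3
      exact_mod_cast h3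
    rw [integral_eq_zero_iff_of_nonneg (fun x => Set.indicator_nonneg (fun _ _ => by positivity) x)
      hint] at h2
    filter_upwards [h2] with x hx hxA
    rw [Set.indicator_of_mem (s := A) hxA] at hx
    simpa using hx
  rw [Lp.eq_zero_iff_ae_eq_zero]
  filter_upwards [ae_all_iff.2 key] with x hx
  obtain ⟨n, hn⟩ := exists_nat_ge (‖f x‖ / k x)
  exact hx n ((div_le_iff₀ (hpos x)).1 hn)

end Lp

/-! ### Semigroups with a positive kernel -/

namespace HasPositiveKernel

variable {𝕜 X : Type*} [RCLike 𝕜] [MeasurableSpace X] {m : Measure X}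
  {L : Lp 𝕜 2 m →ₗ.[𝕜] Lp 𝕜 2 m} {p : ℝ → X → X → ℝ}

local notation "⟪" x ", " y "⟫" => inner 𝕜 x y

theorem measurable_uncurry (hp : L.HasPositiveKernel p) {t : ℝ} (ht : 0 < t) :
    Measurable fun q : X × X => p t q.1 q.2 :=
  hp.measurable.comp ((measurable_const (a := (⟨t, ht⟩ : Set.Ioi (0 : ℝ)))).prodMk measurable_id)

theorem measurable_right (hp : L.HasPositiveKernel p) {t : ℝ} (ht : 0 < t) (x : X) :
    Measurable (p t x) :=
  (hp.measurable_uncurry ht).comp measurable_prodMk_left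

theorem integrable_mul (hp : L.HasPositiveKernel p) {t : ℝ} (ht : 0 < t) (x : X) {k : X → ℝ}
    (hk : MemLp k 2 m) : Integrable (fun y => p t x y * k y) m :=
  (hp.memLp t ht x).integrable_mul hk

theorem integrable_ofReal_mul (hp : L.HasPositiveKernel p) {t : ℝ} (ht : 0 < t) (x : X)
    (f : Lp 𝕜 2 m) : Integrable (fun y => (p t x y : 𝕜) * f y) m :=
  (hp.memLp t ht x).ofReal.integrable_mul (Lp.memLp f)

theorem measure_ne_zero (hp : L.HasPositiveKernel p) (x : X) : m ≠ 0 := by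
  intro h0
  have h1 := hp.add_eq_integral 1 1 one_pos one_pos x x
  rw [h0, integral_zero_measure] at h1
  exact (hp.pos _ (by norm_num) x x).ne' h1

theorem integral_mul_pos (hp : L.HasPositiveKernel p) {t : ℝ} (ht : 0 < t) (x : X) {k : X → ℝ}
    (hk : MemLp k 2 m) (h0 : ∀ᵐ y ∂m, 0 ≤ k y) (hne : ¬ k =ᵐ[m] 0) : 0 < ∫ y, p t x y * k y ∂m := by
  have hnn : 0 ≤ᵐ[m] fun y => p t x y * k y := by
    filter_upwards [h0] with y hy
    exact mul_nonneg (hp.pos t ht x y).le hy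
  refine lt_of_le_of_ne (integral_nonneg_of_ae hnn) fun h => hne ?_
  have := (integral_eq_zero_iff_of_nonneg_ae hnn (hp.integrable_mul ht x hk)).1 h.symm
  filter_upwards [this] with y hy
  exact (mul_eq_zero.1 hy).resolve_left (hp.pos t ht x y).ne'

/-- On real functions the semigroup acts by the real integral operator. -/
theorem expNeg_ae_eq_ofReal (hp : L.HasPositiveKernel p) {t : ℝ} (ht : 0 < t) {f : Lp 𝕜 2 m}
    {k : X → ℝ} (hf : f =ᵐ[m] fun x => (k x : 𝕜)) :
    L.expNeg t f =ᵐ[m] fun x => ((∫ y, p t x y * k y ∂m : ℝ) : 𝕜) := by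
  filter_upwards [hp.expNeg_ae_eq t ht f] with x hx
  rw [hx, ← integral_ofReal]
  refine integral_congr_ae ?_
  filter_upwards [hf] with y hy
  rw [hy, RCLike.ofReal_mul]

theorem expNeg_kernel_ae_eq (hp : L.HasPositiveKernel p) {t s : ℝ} (ht : 0 < t) (hs : 0 < s)
    (y : X) : L.expNeg t (ofRealLp 𝕜 (hp.memLp s hs y)) =ᵐ[m] fun x => (p (t + s) x y : 𝕜) := by
  filter_upwards [hp.expNeg_ae_eq_ofReal ht (coeFn_ofRealLp (𝕜 := 𝕜) (hp.memLp s hs y))] with x hx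
  rw [hx, hp.add_eq_integral t s ht hs]
  simp only [hp.symm s hs y]

/-- `-L` does generate a semigroup: otherwise `expNeg` would be zero by its definition, against the
positivity of the kernel. -/
theorem isSemigroupOf (hp : L.HasPositiveKernel p) (x : X) : L.IsSemigroupOf L.expNeg := by
  by_cases h : ∃ T : ℝ → Lp 𝕜 2 m →L[𝕜] Lp 𝕜 2 m, L.IsSemigroupOf T
  · have : L.expNeg = h.choose := by
      funext t
      rw [expNeg, dif_pos h]
    rw [this]
    exact h.choose_spec
  · exfalso
    have h1 := hp.expNeg_kernel_ae_eq one_pos one_pos x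
    rw [expNeg, dif_neg h, _root_.zero_apply] at h1
    have h2 : ∀ᵐ z ∂m, False := by
      filter_upwards [h1, Lp.coeFn_zero 𝕜 2 m] with z h3 h4
      rw [h3] at h4
      have h5 : p (1 + 1) z x = 0 := by simpa using h4
      exact (hp.pos _ (by norm_num) z x).ne' h5
    rw [ae_iff] at h2
    exact hp.measure_ne_zero x (Measure.measure_univ_eq_zero.1 (by simpa using h2))

theorem nontrivial (hp : L.HasPositiveKernel p) (x : X) : Nontrivial (Lp 𝕜 2 m) := by
  refine ⟨ofRealLp 𝕜 (hp.memLp 1 one_pos x), 0, fun h => ?_⟩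
  have h1 := coeFn_ofRealLp (𝕜 := 𝕜) (hp.memLp 1 one_pos x)
  rw [h] at h1
  have h2 := hp.add_eq_integral 1 1 one_pos one_pos x x
  rw [integral_eq_zero_of_ae] at h2
  · exact (hp.pos _ (by norm_num) x x).ne' h2
  · filter_upwards [h1, Lp.coeFn_zero 𝕜 2 m] with z h3 h4
    rw [h3] at h4
    have h5 : p 1 x z = 0 := by simpa using h4
    simp [h5]

/-- The modulus of `e^{-tL} f` is dominated by `e^{-tL} k` if that of `f` is dominated by `k`. -/
theorem norm_expNeg_ae_le (hp : L.HasPositiveKernel p) {t : ℝ} (ht : 0 < t) {f : Lp 𝕜 2 m}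
    {k : X → ℝ} (hk : MemLp k 2 m) (hf : ∀ᵐ x ∂m, ‖f x‖ ≤ k x) :
    ∀ᵐ x ∂m, ‖L.expNeg t f x‖ ≤ ∫ y, p t x y * k y ∂m := by
  filter_upwards [hp.expNeg_ae_eq t ht f] with x hx
  rw [hx]
  refine (norm_integral_le_integral_norm _).trans
    (integral_mono_ae (hp.integrable_ofReal_mul ht x f).norm (hp.integrable_mul ht x hk) ?_)
  filter_upwards [hf] with y hy
  rw [norm_mul, RCLike.norm_ofReal, abs_of_pos (hp.pos t ht x y)]
  exact mul_le_mul_of_nonneg_left hy (hp.pos t ht x y).le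

/-- As the kernel is positive, domination of vectors by nonnegative functions carries over to the
form of `e^{-tL}`. -/
theorem re_inner_expNeg_le (hp : L.HasPositiveKernel p) {t : ℝ} (ht : 0 < t)
    {f g : Lp 𝕜 2 m} {k l : X → ℝ} (hk : MemLp k 2 m) (hl : MemLp l 2 m)
    (hf : ∀ᵐ x ∂m, ‖f x‖ ≤ k x) (hg : ∀ᵐ x ∂m, ‖g x‖ ≤ l x) :
    RCLike.re ⟪L.expNeg t f, g⟫
      ≤ RCLike.re ⟪L.expNeg t (ofRealLp 𝕜 hk), ofRealLp 𝕜 hl⟫ := by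
  rw [L2.inner_def, L2.inner_def, ← integral_re (L2.integrable_inner _ _),
    ← integral_re (L2.integrable_inner _ _)]
  refine integral_mono_ae (L2.integrable_inner _ _).re (L2.integrable_inner _ _).re ?_
  filter_upwards [hp.norm_expNeg_ae_le ht hk hf, hg,
    hp.expNeg_ae_eq_ofReal ht (coeFn_ofRealLp (𝕜 := 𝕜) hk), coeFn_ofRealLp (𝕜 := 𝕜) hl]
    with x h1 h2 h3 h4
  refine (re_inner_le_norm _ _).trans ?_
  rw [h3, h4, RCLike.inner_apply', RCLike.conj_ofReal, ← RCLike.ofReal_mul, RCLike.ofReal_re]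
  exact mul_le_mul h1 h2 (norm_nonneg _) ((norm_nonneg _).trans h1)

theorem integrable_prod [SigmaFinite m] (hp : L.HasPositiveKernel p) {t : ℝ} (ht : 0 < t)
    (f g : Lp 𝕜 2 m) :
    Integrable (Function.uncurry fun x y => starRingEnd 𝕜 (f y) * ((p t x y : 𝕜) * g x))
      (m.prod m) := by
  have hmeas : AEStronglyMeasurable
      (Function.uncurry fun x y => starRingEnd 𝕜 (f y) * ((p t x y : 𝕜) * g x)) (m.prod m) := by
    have hf := (Lp.stronglyMeasurable f).measurable
    have hg := (Lp.stronglyMeasurable g).measurable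
    have hpm := hp.measurable_uncurry ht
    refine Measurable.aestronglyMeasurable ?_
    exact (RCLike.continuous_conj.measurable.comp (hf.comp measurable_snd)).mul
      ((RCLike.measurable_ofReal.comp hpm).mul (hg.comp measurable_fst))
  rw [integrable_prod_iff hmeas]
  constructor
  · refine Eventually.of_forall fun x => ?_
    have h1 := ((hp.memLp t ht x).ofReal (K := 𝕜)).integrable_mul (Lp.memLp f).star
    exact (h1.mul_const (g x)).congr (Eventually.of_forall fun y => by
      simp only [Function.uncurry, Pi.mul_apply, Pi.star_apply, RCLike.star_def]
      ring)
  · have h1 := (Lp.memLp (L.expNeg t (ofRealLp 𝕜 (Lp.memLp f).norm))).norm.integrable_mul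
      (Lp.memLp g).norm
    refine h1.congr ?_
    filter_upwards [hp.expNeg_ae_eq_ofReal ht (coeFn_ofRealLp (𝕜 := 𝕜) (Lp.memLp f).norm)] with x hx
    have hnn : 0 ≤ ∫ y, p t x y * ‖f y‖ ∂m :=
      integral_nonneg fun y => mul_nonneg (hp.pos t ht x y).le (norm_nonneg _)
    rw [Pi.mul_apply, hx, RCLike.norm_ofReal, abs_of_nonneg hnn, ← integral_mul_const]
    refine integral_congr_ae (Eventually.of_forall fun y => ?_)
    simp only [Function.uncurry, norm_mul, RCLike.norm_conj, RCLike.norm_ofReal,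
      abs_of_pos (hp.pos t ht x y)]
    ring

/-- The semigroup is symmetric, by Fubini's theorem. -/
theorem inner_expNeg [SigmaFinite m] (hp : L.HasPositiveKernel p) {t : ℝ} (ht : 0 < t)
    (f g : Lp 𝕜 2 m) : ⟪L.expNeg t f, g⟫ = ⟪f, L.expNeg t g⟫ := by
  rw [L2.inner_def, L2.inner_def]
  have e1 : ∫ x, ⟪L.expNeg t f x, g x⟫ ∂m
      = ∫ x, ∫ y, starRingEnd 𝕜 (f y) * ((p t x y : 𝕜) * g x) ∂m ∂m := by
    refine integral_congr_ae ?_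
    filter_upwards [hp.expNeg_ae_eq t ht f] with x hx
    rw [hx, RCLike.inner_apply', ← integral_conj, ← integral_mul_const]
    refine integral_congr_ae (Eventually.of_forall fun y => ?_)
    simp only [map_mul, RCLike.conj_ofReal]
    ring
  have e2 : ∫ y, ⟪f y, L.expNeg t g y⟫ ∂m
      = ∫ y, ∫ x, starRingEnd 𝕜 (f y) * ((p t x y : 𝕜) * g x) ∂m ∂m := by
    refine integral_congr_ae ?_
    filter_upwards [hp.expNeg_ae_eq t ht g] with y hy
    rw [hy, RCLike.inner_apply', ← integral_const_mul]
    refine integral_congr_ae (Eventually.of_forall fun x => ?_)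
    simp only [hp.symm t ht y x]
  rw [e1, e2]
  exact integral_integral_swap (hp.integrable_prod ht f g)

theorem inner_expNeg_of_nonneg [SigmaFinite m] (hp : L.HasPositiveKernel p) (x : X) (t : ℝ)
    (ht : 0 ≤ t) (f g : Lp 𝕜 2 m) : ⟪L.expNeg t f, g⟫ = ⟪f, L.expNeg t g⟫ := by
  rcases ht.eq_or_lt with rfl | ht
  · simp [(hp.isSemigroupOf x).zero_eq_one]
  · exact hp.inner_expNeg ht f g

/-- The normalized semigroup `e^{tE₀} e^{-tL}` consists of symmetric contractions. -/
theorem isSymmContractionSemigroup [SigmaFinite m] (hp : L.HasPositiveKernel p)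
    (hL : IsSelfAdjoint L) (x : X) : IsSymmContractionSemigroup (normalized L L.expNeg) := by
  have := hp.nontrivial x
  exact (hp.isSemigroupOf x).isSymmContractionSemigroup hL (hp.inner_expNeg_of_nonneg x)

/-- The kernel as a matrix coefficient of the normalized semigroup at the vectors `p₁(x, ·)`. -/
theorem inner_normalized_kernel (hp : L.HasPositiveKernel p) {t : ℝ} (ht : 0 < t) (x y : X) :
    ⟪normalized L L.expNeg t (ofRealLp 𝕜 (hp.memLp 1 one_pos x)),
      ofRealLp 𝕜 (hp.memLp 1 one_pos y)⟫
      = ((Real.exp (t * L.groundStateEnergy) * p (t + 2) x y : ℝ) : 𝕜) := by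
  rw [normalized_apply, inner_smul_left, RCLike.conj_ofReal, RCLike.ofReal_mul,
    inner_eq_integral_of_ae_eq (hp.expNeg_kernel_ae_eq ht one_pos x) (coeFn_ofRealLp _)]
  congr 2
  rw [show t + 2 = (t + 1) + 1 by ring, hp.add_eq_integral (t + 1) 1 (by linarith) one_pos]
  simp only [hp.symm (t + 1) (by linarith : 0 < t + 1) x, hp.symm 1 one_pos y]

/-! ### The ground state -/

/-- If `u` is fixed, then so is `|u|`: passing to the modulus does not change the norm and does not
decrease the form of the semigroup. -/
theorem normalized_norm_eq [SigmaFinite m] (hp : L.HasPositiveKernel p) (hL : IsSelfAdjoint L)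
    (x : X) {t : ℝ} (ht : 0 < t) {u : Lp 𝕜 2 m} (hu : normalized L L.expNeg t u = u) :
    normalized L L.expNeg t (ofRealLp 𝕜 (Lp.memLp u).norm) = ofRealLp 𝕜 (Lp.memLp u).norm := by
  have hS := hp.isSymmContractionSemigroup hL x
  refine hS.apply_eq_of_le_re_inner ht.le ?_
  have h1 : ‖ofRealLp 𝕜 (Lp.memLp u).norm‖ ≤ ‖u‖ := by
    refine Lp.norm_le_norm_of_ae_le ?_
    filter_upwards [coeFn_ofRealLp (𝕜 := 𝕜) (Lp.memLp u).norm] with z hz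
    rw [hz, RCLike.norm_ofReal, abs_norm]
  have h2 : RCLike.re ⟪normalized L L.expNeg t u, u⟫ = ‖u‖ ^ 2 := by
    rw [hu, inner_self_eq_norm_sq]
  calc ‖ofRealLp 𝕜 (Lp.memLp u).norm‖ ^ 2 ≤ ‖u‖ ^ 2 := by gcongr
    _ ≤ _ := by
      rw [← h2]
      simp only [normalized_apply, inner_smul_left, RCLike.conj_ofReal, RCLike.re_ofReal_mul]
      refine mul_le_mul_of_nonneg_left ?_ (Real.exp_pos _).le
      exact hp.re_inner_expNeg_le ht _ _ (Eventually.of_forall fun _ => le_rfl)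
        (Eventually.of_forall fun _ => le_rfl)

theorem ae_eq_of_normalized_norm_eq (hp : L.HasPositiveKernel p) {u : Lp 𝕜 2 m}
    (hu : normalized L L.expNeg 1 (ofRealLp 𝕜 (Lp.memLp u).norm) = ofRealLp 𝕜 (Lp.memLp u).norm) :
    ∀ᵐ x ∂m, Real.exp L.groundStateEnergy * ∫ y, p 1 x y * ‖u y‖ ∂m = ‖u x‖ := by
  have h1 := Lp.coeFn_smul (Real.exp (1 * L.groundStateEnergy) : 𝕜)
    (L.expNeg 1 (ofRealLp 𝕜 (Lp.memLp u).norm))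
  rw [← normalized_apply, hu] at h1
  filter_upwards [h1, coeFn_ofRealLp (𝕜 := 𝕜) (Lp.memLp u).norm,
    hp.expNeg_ae_eq_ofReal one_pos (coeFn_ofRealLp (𝕜 := 𝕜) (Lp.memLp u).norm)] with x h2 h3 h4
  rw [h3, Pi.smul_apply, h4, smul_eq_mul, ← RCLike.ofReal_mul, one_mul] at h2
  exact (RCLike.ofReal_injective h2).symm

theorem not_norm_ae_eq_zero {u : Lp 𝕜 2 m} (hu : u ≠ 0) : ¬ (fun x => ‖u x‖) =ᵐ[m] 0 := by
  intro h
  refine hu (Lp.eq_zero_iff_ae_eq_zero.2 ?_)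
  filter_upwards [h] with x hx
  simpa using hx

/-- If the normalized semigroup has a fixed unit vector, then it has one given by an everywhere
strictly positive function, namely `e^{E₀} ∫ p₁(·, y) |u(y)| dm(y)`. -/
theorem exists_pos_fixed [SigmaFinite m] (hp : L.HasPositiveKernel p) (hL : IsSelfAdjoint L)
    (x₀ : X) {u : Lp 𝕜 2 m} (hu : ‖u‖ = 1) (hfix : ∀ t, 0 < t → normalized L L.expNeg t u = u) :
    ∃ (Φ : X → ℝ) (hΦ : MemLp Φ 2 m), Measurable Φ ∧ (∀ x, 0 < Φ x) ∧ ‖ofRealLp 𝕜 hΦ‖ = 1 ∧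
      (∀ t, 0 < t → normalized L L.expNeg t (ofRealLp 𝕜 hΦ) = ofRealLp 𝕜 hΦ) ∧
      ∀ x, Φ x = Real.exp L.groundStateEnergy * ∫ y, p 1 x y * Φ y ∂m := by
  have hw := fun t ht => hp.normalized_norm_eq hL x₀ ht (hfix t ht)
  have hae := hp.ae_eq_of_normalized_norm_eq (hw 1 one_pos)
  set Φ : X → ℝ := fun x => Real.exp L.groundStateEnergy * ∫ y, p 1 x y * ‖u y‖ ∂m with hΦdef
  have hΦ : MemLp Φ 2 m := (memLp_congr_ae hae).2 (Lp.memLp u).norm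
  have hw' : ofRealLp 𝕜 hΦ = ofRealLp 𝕜 (Lp.memLp u).norm := by
    refine Lp.ext ?_
    filter_upwards [hae, coeFn_ofRealLp (𝕜 := 𝕜) hΦ, coeFn_ofRealLp (𝕜 := 𝕜) (Lp.memLp u).norm]
      with x h1 h2 h3
    rw [h2, h3, ← h1]
  refine ⟨Φ, hΦ, ?_, fun x => ?_, ?_, fun t ht => by rw [hw', hw t ht], fun x => ?_⟩
  · have h1 : StronglyMeasurable fun q : X × X => p 1 q.1 q.2 * ‖u q.2‖ :=
      ((hp.measurable_uncurry one_pos).mul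
        ((Lp.stronglyMeasurable u).norm.measurable.comp measurable_snd)).stronglyMeasurable
    exact h1.integral_prod_right'.measurable.const_mul _
  · refine mul_pos (Real.exp_pos _) (hp.integral_mul_pos one_pos x (Lp.memLp u).norm
      (Eventually.of_forall fun _ => norm_nonneg _) (not_norm_ae_eq_zero ?_))
    rintro rfl
    simp at hu
  · rw [← hu, hw']
    refine le_antisymm (Lp.norm_le_norm_of_ae_le ?_) (Lp.norm_le_norm_of_ae_le ?_)
    all_goals
      filter_upwards [coeFn_ofRealLp (𝕜 := 𝕜) (Lp.memLp u).norm] with z hz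
      rw [hz, RCLike.norm_ofReal, abs_norm]
  · rw [hΦdef]
    simp only
    congr 1
    refine integral_congr_ae ?_
    filter_upwards [hae] with y hy
    rw [hy]

/-- The space of fixed vectors is one-dimensional. For a fixed vector `v`, also `|v|` is fixed, so
the integral `I = ∫ p₁(x, y) v(y) dm(y)` satisfies `|I| = ∫ p₁(x, y) |v(y)| dm(y)` for some `x`.
As `p₁ > 0`, this forces `v` to have the constant phase of `I`, and then `v` cannot be orthogonal
to a positive function unless it vanishes. -/
theorem eq_zero_of_inner_eq_zero [SigmaFinite m] (hp : L.HasPositiveKernel p)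
    (hL : IsSelfAdjoint L) (x₀ : X) {Φ : X → ℝ} (hΦ : MemLp Φ 2 m) (hpos : ∀ x, 0 < Φ x)
    {v : Lp 𝕜 2 m} (hv : normalized L L.expNeg 1 v = v) (h0 : ⟪ofRealLp 𝕜 hΦ, v⟫ = 0) :
    v = 0 := by
  by_contra hne
  have hae := hp.ae_eq_of_normalized_norm_eq (hp.normalized_norm_eq hL x₀ one_pos hv)
  have hv1 : ∀ᵐ x ∂m, (Real.exp L.groundStateEnergy : 𝕜) * ∫ y, (p 1 x y : 𝕜) * v y ∂m = v x := by
    have h1 := Lp.coeFn_smul (Real.exp (1 * L.groundStateEnergy) : 𝕜) (L.expNeg 1 v)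
    rw [← normalized_apply, hv] at h1
    filter_upwards [h1, hp.expNeg_ae_eq 1 one_pos v] with x h2 h3
    rw [h2, Pi.smul_apply, h3, smul_eq_mul, one_mul]
  have : (ae m).NeBot := ae_neBot.2 (hp.measure_ne_zero x₀)
  obtain ⟨x, hx1, hx2⟩ := (hv1.and hae).exists
  set I : 𝕜 := ∫ y, (p 1 x y : 𝕜) * v y ∂m with hI
  have hIn : ‖I‖ = ∫ y, p 1 x y * ‖v y‖ ∂m := by
    rw [← hx1, norm_mul, RCLike.norm_ofReal, abs_of_pos (Real.exp_pos _)] at hx2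
    exact (mul_left_cancel₀ (Real.exp_pos _).ne' hx2).symm
  have hIpos : 0 < ‖I‖ := by
    rw [hIn]
    exact hp.integral_mul_pos one_pos x (Lp.memLp v).norm
      (Eventually.of_forall fun _ => norm_nonneg _) (not_norm_ae_eq_zero hne)
  have hre : MemLp (fun y => RCLike.re (starRingEnd 𝕜 I * v y)) 2 m :=
    ((Lp.memLp v).const_mul _).re
  have hphase : (fun y => ‖I‖ * ‖v y‖ - RCLike.re (starRingEnd 𝕜 I * v y)) =ᵐ[m] 0 := by
    by_contra hcon
    have h1 := hp.integral_mul_pos one_pos x (((Lp.memLp v).norm.const_mul ‖I‖).sub hre)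
      (Eventually.of_forall fun y => by
        have := RCLike.re_le_norm (starRingEnd 𝕜 I * v y)
        rw [norm_mul, RCLike.norm_conj] at this
        exact sub_nonneg.2 this) hcon
    simp only [Pi.sub_apply, mul_sub] at h1
    rw [integral_sub (hp.integrable_mul one_pos x ((Lp.memLp v).norm.const_mul ‖I‖))
      (hp.integrable_mul one_pos x hre)] at h1
    have h2 : ∫ y, p 1 x y * (‖I‖ * ‖v y‖) ∂m = ‖I‖ ^ 2 := by
      rw [sq]
      nth_rewrite 3 [hIn]
      rw [← integral_const_mul]
      exact integral_congr_ae (Eventually.of_forall fun y => by ring_nf)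
    have h3 : ∫ y, p 1 x y * RCLike.re (starRingEnd 𝕜 I * v y) ∂m = ‖I‖ ^ 2 := by
      have h4 : starRingEnd 𝕜 I * I = ∫ y, starRingEnd 𝕜 I * ((p 1 x y : 𝕜) * v y) ∂m := by
        rw [integral_const_mul]
      have h5 := congrArg RCLike.re h4
      rw [← integral_re ((hp.integrable_ofReal_mul one_pos x v).const_mul _), RCLike.conj_mul] at h5
      have h6 : RCLike.re ((‖I‖ : 𝕜) ^ 2) = ‖I‖ ^ 2 := by
        rw [← RCLike.ofReal_pow, RCLike.ofReal_re]
      rw [← h6, h5]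
      refine integral_congr_ae (Eventually.of_forall fun y => ?_)
      simp only
      rw [mul_left_comm, RCLike.re_ofReal_mul]
    rw [h2, h3, sub_self] at h1
    exact lt_irrefl _ h1
  have hzero : ∫ y, Φ y * ‖v y‖ ∂m = 0 := by
    have h1 : ∫ y, (Φ y : 𝕜) * v y ∂m = 0 := by
      rw [← h0, L2.inner_def]
      refine integral_congr_ae ?_
      filter_upwards [coeFn_ofRealLp (𝕜 := 𝕜) hΦ] with y hy
      rw [hy, RCLike.inner_apply', RCLike.conj_ofReal]
    have hint : Integrable (fun y => (Φ y : 𝕜) * v y) m :=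
      (hΦ.ofReal (K := 𝕜)).integrable_mul (Lp.memLp v)
    have h2 : ∫ y, RCLike.re (starRingEnd 𝕜 I * ((Φ y : 𝕜) * v y)) ∂m = 0 := by
      rw [integral_re (hint.const_mul _), integral_const_mul, h1, mul_zero, _root_.map_zero]
    have h3 : ‖I‖ * ∫ y, Φ y * ‖v y‖ ∂m = 0 := by
      rw [← h2, ← integral_const_mul]
      refine integral_congr_ae ?_
      filter_upwards [hphase] with y hy
      rw [mul_left_comm (starRingEnd 𝕜 I), RCLike.re_ofReal_mul, ← sub_eq_zero.1 hy]
      ring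
    exact (mul_eq_zero.1 h3).resolve_left hIpos.ne'
  rw [integral_eq_zero_iff_of_nonneg (fun y => mul_nonneg (hpos y).le (norm_nonneg _))
    (hΦ.integrable_mul (Lp.memLp v).norm)] at hzero
  refine not_norm_ae_eq_zero hne ?_
  filter_upwards [hzero] with y hy
  exact (mul_eq_zero.1 hy).resolve_left (hpos y).ne'

/-- In the presence of a ground state `Φ`, the strong limit of the normalized semigroup is the
orthogonal projection onto the span of `Φ`. -/
theorem tendsto_normalized_of_pos_fixed [SigmaFinite m] (hp : L.HasPositiveKernel p)
    (hL : IsSelfAdjoint L) (x₀ : X) {Φ : X → ℝ} (hΦ : MemLp Φ 2 m) (hpos : ∀ x, 0 < Φ x)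
    (hn : ‖ofRealLp 𝕜 hΦ‖ = 1)
    (hfix : ∀ t, 0 < t → normalized L L.expNeg t (ofRealLp 𝕜 hΦ) = ofRealLp 𝕜 hΦ) (f : Lp 𝕜 2 m) :
    Tendsto (fun t => normalized L L.expNeg t f) atTop
      (𝓝 (⟪ofRealLp 𝕜 hΦ, f⟫ • ofRealLp 𝕜 hΦ)) := by
  have hS := hp.isSymmContractionSemigroup hL x₀
  obtain ⟨g, hg, hgfix⟩ := hS.exists_tendsto f
  have hin : ⟪ofRealLp 𝕜 hΦ, g⟫ = ⟪ofRealLp 𝕜 hΦ, f⟫ := by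
    refine tendsto_nhds_unique (tendsto_const_nhds.inner hg) (tendsto_const_nhds.congr' ?_)
    filter_upwards [eventually_gt_atTop 0] with t ht
    rw [← hS.inner_eq t ht.le, hfix t ht]
  have h0 : g - ⟪ofRealLp 𝕜 hΦ, f⟫ • ofRealLp 𝕜 hΦ = 0 := by
    refine hp.eq_zero_of_inner_eq_zero hL x₀ hΦ hpos ?_ ?_
    · rw [_root_.map_sub, _root_.map_smul, hfix 1 one_pos, hgfix 1 zero_le_one]
    · rw [inner_sub_right, inner_smul_right, inner_self_eq_norm_sq_to_K, hn, hin]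
      simp
  rwa [← sub_eq_zero.1 h0]

/-- Strong convergence of the normalized semigroup gives pointwise convergence of the kernel. -/
theorem tendsto_kernel (hp : L.HasPositiveKernel p) (x y : X) {g : Lp 𝕜 2 m}
    (hg : Tendsto (fun t => normalized L L.expNeg t (ofRealLp 𝕜 (hp.memLp 1 one_pos x))) atTop (𝓝 g))
    {b : ℝ} (hb : ⟪g, ofRealLp 𝕜 (hp.memLp 1 one_pos y)⟫ = (b : 𝕜)) :
    Tendsto (fun t : ℝ => Real.exp (t * L.groundStateEnergy) * p t x y) atTop
      (𝓝 (Real.exp (2 * L.groundStateEnergy) * b)) := by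
  have h1 := (RCLike.continuous_re.tendsto _).comp (hg.inner (𝕜 := 𝕜)
    (tendsto_const_nhds (x := ofRealLp 𝕜 (hp.memLp 1 one_pos y))))
  rw [hb, RCLike.ofReal_re] at h1
  have h2 := (h1.const_mul (Real.exp (2 * L.groundStateEnergy))).comp
    (tendsto_atTop_add_const_right atTop (-2) tendsto_id)
  refine h2.congr' ?_
  filter_upwards [eventually_gt_atTop 2] with t ht
  simp only [Function.comp_apply, id]
  rw [hp.inner_normalized_kernel (by linarith), RCLike.ofReal_re, ← mul_assoc, ← Real.exp_add,
    neg_add_cancel_right]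
  ring_nf

/-! ### The exponential growth rate of the kernel -/

/-- Both kernel functions `p₁(x, ·)` and `p₁(y, ·)` dominate their minimum, which is strictly
positive and hence dominates a dense set of vectors. -/
theorem eventually_exp_le_kernel [SigmaFinite m] (hp : L.HasPositiveKernel p)
    (hL : IsSelfAdjoint L) (x y : X) {ε : ℝ} (hε : 0 < ε) :
    ∀ᶠ t in atTop, Real.exp (-(ε * t)) ≤ Real.exp (t * L.groundStateEnergy) * p (t + 2) x y := by
  have := hp.nontrivial x
  set k : X → ℝ := fun z => min (p 1 x z) (p 1 y z) with hkdef
  have hkpos : ∀ z, 0 < k z := fun z => lt_min (hp.pos 1 one_pos x z) (hp.pos 1 one_pos y z)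
  have hkm : Measurable k := (hp.measurable_right one_pos x).min (hp.measurable_right one_pos y)
  have hk : MemLp k 2 m := by
    refine (hp.memLp 1 one_pos x).mono hkm.aestronglyMeasurable (Eventually.of_forall fun z => ?_)
    rw [Real.norm_of_nonneg (hkpos z).le, Real.norm_of_nonneg (hp.pos 1 one_pos x z).le]
    exact min_le_left _ _
  have hle : ∀ w : X, (∀ z, k z ≤ p 1 w z) →
      ∀ᵐ z ∂m, ‖(ofRealLp 𝕜 hk : X → 𝕜) z‖ ≤ p 1 w z := fun w hw => by
    filter_upwards [coeFn_ofRealLp (𝕜 := 𝕜) hk] with z hz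
    rw [hz, RCLike.norm_ofReal, abs_of_pos (hkpos z)]
    exact hw z
  have hev := (hp.isSymmContractionSemigroup hL x).eventually_exp_le
    (fun κ hκ => (hp.isSemigroupOf x).exists_lt_re_inner_normalized hL
      (hp.inner_expNeg_of_nonneg x) hκ)
    (dense_setOf_norm_le (𝕜 := 𝕜) (m := m) hkm hkpos) (h := ofRealLp 𝕜 hk) (by
      rintro g ⟨C, hC, hg⟩
      refine ⟨C ^ 2, fun t ht => ?_⟩
      have h1 := hp.re_inner_expNeg_le ht (hk.const_mul C) (hk.const_mul C) hg hg
      have h2 : ofRealLp 𝕜 (hk.const_mul C) = (C : 𝕜) • ofRealLp 𝕜 hk := by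
        refine Lp.ext ?_
        filter_upwards [coeFn_ofRealLp (𝕜 := 𝕜) (hk.const_mul C), coeFn_ofRealLp (𝕜 := 𝕜) hk,
          Lp.coeFn_smul (C : 𝕜) (ofRealLp 𝕜 hk)] with z e1 e2 e3
        rw [e1, e3, Pi.smul_apply, e2, RCLike.ofReal_mul, smul_eq_mul]
      rw [h2, _root_.map_smul, inner_smul_left, inner_smul_right, RCLike.conj_ofReal,
        RCLike.re_ofReal_mul, RCLike.re_ofReal_mul, ← mul_assoc, ← sq] at h1
      simp only [normalized_apply, inner_smul_left, RCLike.conj_ofReal, RCLike.re_ofReal_mul]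
      rw [mul_left_comm]
      gcongr) hε
  filter_upwards [hev, eventually_gt_atTop 0] with t h1 ht
  refine h1.trans ?_
  have h2 := hp.inner_normalized_kernel ht x y
  rw [normalized_apply, inner_smul_left, RCLike.conj_ofReal] at h2
  have h3 := congrArg RCLike.re h2
  rw [RCLike.ofReal_re, RCLike.re_ofReal_mul] at h3
  rw [← h3, normalized_apply, inner_smul_left, RCLike.conj_ofReal, RCLike.re_ofReal_mul]
  refine mul_le_mul_of_nonneg_left ?_ (Real.exp_pos _).le
  exact hp.re_inner_expNeg_le ht (hp.memLp 1 one_pos x) (hp.memLp 1 one_pos y)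
    (hle x fun z => min_le_left _ _) (hle y fun z => min_le_right _ _)

theorem exists_kernel_le [SigmaFinite m] (hp : L.HasPositiveKernel p) (hL : IsSelfAdjoint L)
    (x y : X) :
    ∃ M, ∀ t, 0 < t → Real.exp (t * L.groundStateEnergy) * p (t + 2) x y ≤ M := by
  refine ⟨‖ofRealLp 𝕜 (hp.memLp 1 one_pos x)‖ * ‖ofRealLp 𝕜 (hp.memLp 1 one_pos y)‖,
    fun t ht => ?_⟩
  have h1 := congrArg RCLike.re (hp.inner_normalized_kernel ht x y)
  rw [RCLike.ofReal_re] at h1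
  rw [← h1]
  refine (re_inner_le_norm _ _).trans ?_
  gcongr
  exact (hp.isSymmContractionSemigroup hL x).norm_apply_le t ht.le _

theorem tendsto_log_kernel [SigmaFinite m] (hp : L.HasPositiveKernel p) (hL : IsSelfAdjoint L)
    (x y : X) :
    Tendsto (fun t : ℝ => Real.log (p t x y) / t) atTop (𝓝 (-L.groundStateEnergy)) := by
  set c := L.groundStateEnergy with hc
  obtain ⟨M, hM⟩ := hp.exists_kernel_le hL x y
  rw [← hc] at hM
  rw [Metric.tendsto_atTop']
  intro ε hε
  have hsh := tendsto_atTop_add_const_right atTop (-2 : ℝ) tendsto_id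
  obtain ⟨t₀, ht₀⟩ := eventually_atTop.1 ((hsh.eventually
    (hp.eventually_exp_le_kernel hL x y (half_pos hε))).and
    ((eventually_gt_atTop 2).and (eventually_gt_atTop ((|Real.log M| + 2 * |c|) / (ε / 2)))))
  refine ⟨t₀, fun t ht => ?_⟩
  obtain ⟨h1, h2, h3⟩ := ht₀ t ht.le
  simp only [id, neg_add_cancel_right] at h1
  have hpt := hp.pos t (by linarith) x y
  have h4 := hM (t + -2) (by linarith)
  rw [neg_add_cancel_right] at h4
  have hpos : 0 < Real.exp ((t + -2) * c) * p t x y := by positivity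
  have hlog : Real.log (Real.exp ((t + -2) * c) * p t x y) = (t + -2) * c + Real.log (p t x y) := by
    rw [Real.log_mul (Real.exp_pos _).ne' hpt.ne', Real.log_exp]
  have h5 := Real.log_le_log hpos h4
  have h6 := Real.log_le_log (Real.exp_pos _) h1
  rw [Real.log_exp] at h6
  rw [hlog] at h5 h6
  rw [div_lt_iff₀ (half_pos hε)] at h3
  have ht0 : 0 < t := by linarith
  rw [Real.dist_eq, sub_neg_eq_add, show Real.log (p t x y) / t + c = (Real.log (p t x y) + t * c) / t
    by field_simp, abs_div, abs_of_pos ht0, div_lt_iff₀ ht0, abs_lt]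
  have := le_abs_self (Real.log M)
  have := le_abs_self c
  have := neg_abs_le c
  have := abs_nonneg (Real.log M)
  constructor <;> nlinarith

end HasPositiveKernel

end LinearPMap

theorem mainTheorem1 {𝕜 X : Type*} [RCLike 𝕜] [MeasurableSpace X] (m : Measure X) [SigmaFinite m]
    (L : Lp 𝕜 2 m →ₗ.[𝕜] Lp 𝕜 2 m) (hL : IsSelfAdjoint L) (hbdd : BddBelow L.realSpectrum)
    (p : ℝ → X → X → ℝ) (hp : L.HasPositiveKernel p) :
    (∃ Φ : X → ℝ,
      (Measurable Φ ∧ (∀ x, 0 ≤ Φ x) ∧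
        ∀ x y, Tendsto (fun t : ℝ => Real.exp (t * L.groundStateEnergy) * p t x y) atTop
          (𝓝 (Φ x * Φ y))) ∧
      (∀ Ψ : X → ℝ,
        (Measurable Ψ ∧ (∀ x, 0 ≤ Ψ x) ∧
          ∀ x y, Tendsto (fun t : ℝ => Real.exp (t * L.groundStateEnergy) * p t x y) atTop
            (𝓝 (Ψ x * Ψ y))) → Ψ = Φ) ∧
      (L.IsEigenvalue L.groundStateEnergy →
        (∀ x, 0 < Φ x) ∧
        ∃ u : L.domain, ((u : Lp 𝕜 2 m) : X → 𝕜) =ᵐ[m] (fun x => (Φ x : 𝕜)) ∧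
          ‖(u : Lp 𝕜 2 m)‖ = 1 ∧ L u = (L.groundStateEnergy : 𝕜) • (u : Lp 𝕜 2 m)) ∧
      (¬ L.IsEigenvalue L.groundStateEnergy → ∀ x, Φ x = 0)) ∧
    (∀ x y, Tendsto (fun t : ℝ => Real.log (p t x y) / t) atTop (𝓝 (-L.groundStateEnergy))) := by
  refine ⟨?_, hp.tendsto_log_kernel hL⟩
  -- Uniqueness only uses the limits on the diagonal.
  have huniq : ∀ Φ : X → ℝ, (∀ x, 0 ≤ Φ x) →
      (∀ x y, Tendsto (fun t : ℝ => Real.exp (t * L.groundStateEnergy) * p t x y) atTop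
        (𝓝 (Φ x * Φ y))) →
      ∀ Ψ : X → ℝ, (Measurable Ψ ∧ (∀ x, 0 ≤ Ψ x) ∧
        ∀ x y, Tendsto (fun t : ℝ => Real.exp (t * L.groundStateEnergy) * p t x y) atTop
          (𝓝 (Ψ x * Ψ y))) → Ψ = Φ := by
    rintro Φ hΦ hlim Ψ ⟨-, hΨ, hlim'⟩
    funext x
    exact (mul_self_inj (hΨ x) (hΦ x)).1 (tendsto_nhds_unique (hlim' x x) (hlim x x))
  by_cases hX : IsEmpty X
  · refine ⟨fun _ => 0, ⟨measurable_const, fun _ => le_rfl, fun x => hX.elim x⟩,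
      fun Ψ _ => funext fun x => hX.elim x, ?_, fun _ _ => rfl⟩
    rintro ⟨u, hu, -⟩
    exact absurd (Lp.ext (Eventually.of_forall fun x => hX.elim x)) hu
  rw [not_isEmpty_iff] at hX
  obtain ⟨x₀⟩ := hX
  have hT := hp.isSemigroupOf x₀
  by_cases hE : L.IsEigenvalue L.groundStateEnergy
  · obtain ⟨v, hv0, hv⟩ := hE
    obtain ⟨u, hun, hufix⟩ : ∃ u : Lp 𝕜 2 m, ‖u‖ = 1 ∧
        ∀ t, 0 < t → LinearPMap.normalized L L.expNeg t u = u := by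
      refine ⟨((‖(v : Lp 𝕜 2 m)‖⁻¹ : ℝ) : 𝕜) • (v : Lp 𝕜 2 m), ?_, fun t ht => ?_⟩
      · rw [norm_smul, RCLike.norm_ofReal, abs_of_nonneg (by positivity),
          inv_mul_cancel₀ (norm_ne_zero_iff.2 hv0)]
      · rw [map_smul, hT.normalized_eq_of_map_eq hv ht.le]
    obtain ⟨Φ, hΦ, hmeas, hpos, hn, hfix, hint⟩ := hp.exists_pos_fixed hL x₀ hun hufix
    have hlim : ∀ x y, Tendsto (fun t : ℝ => Real.exp (t * L.groundStateEnergy) * p t x y) atTop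
        (𝓝 (Φ x * Φ y)) := by
      intro x y
      have h1 := hp.tendsto_kernel x y
        (hp.tendsto_normalized_of_pos_fixed hL x₀ hΦ hpos hn hfix _)
        (b := (∫ z, p 1 x z * Φ z ∂m) * ∫ z, p 1 y z * Φ z ∂m) (by
          have e := fun w => LinearPMap.inner_eq_integral_of_ae_eq (𝕜 := 𝕜)
            (LinearPMap.coeFn_ofRealLp hΦ)
            (LinearPMap.coeFn_ofRealLp (hp.memLp 1 one_pos w))
          rw [inner_smul_left, e, e, RCLike.conj_ofReal, RCLike.ofReal_mul]
          simp only [mul_comm])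
      convert h1 using 2
      rw [hint x, hint y, two_mul, Real.exp_add]
      ring
    obtain ⟨hu, hu'⟩ := hT.map_eq_of_normalized_eq hfix
    exact ⟨Φ, ⟨hmeas, fun x => (hpos x).le, hlim⟩, huniq Φ (fun x => (hpos x).le) hlim,
      fun _ => ⟨hpos, ⟨_, hu⟩, LinearPMap.coeFn_ofRealLp hΦ, hn, hu'⟩,
      fun h => absurd ⟨v, hv0, hv⟩ h⟩
  · have hlim : ∀ x y, Tendsto (fun t : ℝ => Real.exp (t * L.groundStateEnergy) * p t x y) atTop
        (𝓝 ((0 : ℝ) * 0)) := by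
      intro x y
      obtain ⟨g, hg, hgfix⟩ := (hp.isSymmContractionSemigroup hL x₀).exists_tendsto
        (LinearPMap.ofRealLp 𝕜 (hp.memLp 1 one_pos x))
      -- The limit is fixed, so it would be an eigenfunction if it did not vanish.
      have hg0 : g = 0 := by
        by_contra hne
        obtain ⟨hD, hD'⟩ := hT.map_eq_of_normalized_eq fun t ht => hgfix t ht.le
        exact hE ⟨⟨g, hD⟩, hne, hD'⟩
      simpa using hp.tendsto_kernel x y hg (b := 0) (by rw [hg0, inner_zero_left, RCLike.ofReal_zero])
    exact ⟨fun _ => 0, ⟨measurable_const, fun _ => le_rfl, hlim⟩, huniq _ (fun _ => le_rfl) hlim,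
      fun h => absurd h hE, fun _ _ => rfl⟩
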